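/- Let $\mathbf{RCA}_0$ be the usual subsystem of second-order arithmetic, consisting of the basic axioms of arithmetic, $\Sigma^0_1$-induction and $\Delta^0_1$-comprehension (the latter two with arbitrary number and set parameters). Let $(\mathcal{WF}2)$ be the statement that for any infinite sequence of (countable) well orders $L_0,L_1,\ldots$ there are indices $i\neq j$ such that $L_i$ embeds into $L_j$. Then $\mathbf{RCA}_0$ proves that $(\mathcal{WF}2)$ implies the principle of $\Sigma^0_2$-induction, i.e. every structure $(M,S)$ for the language of second-order arithmetic (number domain $M$ with $0,1,+,\cdot,<$, set variables ranging over $S\subseteq\mathcal P(M)$) that satisfies $\mathbf{RCA}_0$ and $(\mathcal{WF}2)$ also satisfies, for every $\Sigma^0_2$-formula $\psi$ with number and set parameters, $$\psi(0)\wedge\forall x\,(\psi(x)\to\psi(x+1))\to\forall x\,\psi(x).$$ Here, as usual in $\mathbf{RCA}_0$, a countable linear order is coded by its set of pairs $\{(a,b):a\leq_L b\}$ of numbers, and it is a well order if there is no infinite sequence $f:\mathbb N\to L$ with $f(n+1)<_L f(n)$ for all $n$; an embedding is a strictly order-preserving map; an infinite sequence of orders is coded by a single set $Z$ with $L_i=\{m:(m,i)\in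 Z\}$. All these objects are elements of $S$ when the notions are interpreted in $(M,S)$, and $\mathbb N$ is interpreted by $M$. -/

import Mathlib

/-!
Second-order arithmetic and the base theory `RCA₀`, in the usual semantics.

A structure for the two-sorted language `L₂` of second-order arithmetic consists of a number
domain `M` with `0, 1, +, ·, <` and of a family `S : Set (Set M)`, the range of the set variables.
Neither is assumed to be standard: `M` may be a nonstandard model, and the set quantifiers range
over `S` only. A statement is a theorem of `RCA₀` if it holds in all such structures that satisfy
the axioms of `RCA₀`.
-/

namespace SecondOrderArithmetic

/-- Number terms of `L₂` in the number variables `0, …, n - 1`. -/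
inductive NumTerm (n : ℕ) : Type
  | var (i : Fin n) : NumTerm n
  | zero : NumTerm n
  | one : NumTerm n
  | add (s t : NumTerm n) : NumTerm n
  | mul (s t : NumTerm n) : NumTerm n

/-- Bounded quantifier formulas (`Σ⁰₀` formulas) of `L₂` in the set variables `0, …, k - 1` and
the number variables `0, …, n - 1`. In `ball t φ`, i.e. `∀ a < t, φ`, the bound variable is the
variable `0` of `φ`, and it does not occur in `t`. The connectives and quantifiers that are not
listed are defined by negation. -/
inductive BddFormula (k : ℕ) : ℕ → Type
  | eq {n : ℕ} (s t : NumTerm n) : BddFormula k n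
  | lt {n : ℕ} (s t : NumTerm n) : BddFormula k n
  | mem {n : ℕ} (t : NumTerm n) (i : Fin k) : BddFormula k n
  | neg {n : ℕ} (φ : BddFormula k n) : BddFormula k n
  | and {n : ℕ} (φ ψ : BddFormula k n) : BddFormula k n
  | ball {n : ℕ} (t : NumTerm n) (φ : BddFormula k (n + 1)) : BddFormula k n

section Semantics

variable {M : Type*} [Zero M] [One M] [Add M] [Mul M] [LT M]

/-- The value of a term under an assignment. -/
def NumTerm.eval {n : ℕ} (v : Fin n → M) : NumTerm n → M
  | .var i => v i
  | .zero => 0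
  | .one => 1
  | .add s t => s.eval v + t.eval v
  | .mul s t => s.eval v * t.eval v

/-- Satisfaction of a bounded quantifier formula under an assignment `X` of sets and an
assignment `v` of numbers. -/
def BddFormula.Sat {k : ℕ} (X : Fin k → Set M) : {n : ℕ} → BddFormula k n → (Fin n → M) → Prop
  | _, .eq s t, v => s.eval v = t.eval v
  | _, .lt s t, v => s.eval v < t.eval v
  | _, .mem t i, v => t.eval v ∈ X i
  | _, .neg φ, v => ¬ φ.Sat X v
  | _, .and φ ψ, v => φ.Sat X v ∧ ψ.Sat X v
  | _, .ball t φ, v => ∀ a : M, a < t.eval v → φ.Sat X (Fin.cons a v)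

/-- `P` is given by a formula `φ(x) = ∃ u, θ(u, x)` with `θ` bounded, with number parameters from
`M` and set parameters from `S`. -/
def IsSigma01 (S : Set (Set M)) (P : M → Prop) : Prop :=
  ∃ (k n : ℕ) (θ : BddFormula k (n + 2)) (X : Fin k → Set M) (p : Fin n → M),
    (∀ i, X i ∈ S) ∧ ∀ x, P x ↔ ∃ u : M, θ.Sat X (Fin.cons u (Fin.cons x p))

/-- `P` is given by a formula `φ(x) = ∀ u, θ(u, x)` with `θ` bounded, with parameters. -/
def IsPi01 (S : Set (Set M)) (P : M → Prop) : Prop :=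
  ∃ (k n : ℕ) (θ : BddFormula k (n + 2)) (X : Fin k → Set M) (p : Fin n → M),
    (∀ i, X i ∈ S) ∧ ∀ x, P x ↔ ∀ u : M, θ.Sat X (Fin.cons u (Fin.cons x p))

/-- `P` is given by a formula `φ(x) = ∃ u, ∀ v, θ(v, u, x)` with `θ` bounded, with parameters. -/
def IsSigma02 (S : Set (Set M)) (P : M → Prop) : Prop :=
  ∃ (k n : ℕ) (θ : BddFormula k (n + 3)) (X : Fin k → Set M) (p : Fin n → M),
    (∀ i, X i ∈ S) ∧
      ∀ x, P x ↔ ∃ u : M, ∀ v : M, θ.Sat X (Fin.cons v (Fin.cons u (Fin.cons x p)))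

/-- The universal closure of the induction axiom for `P`, for all `P` in a class `Γ`. -/
def InductionFor (Γ : (M → Prop) → Prop) : Prop :=
  ∀ P : M → Prop, Γ P → P 0 → (∀ x, P x → P (x + 1)) → ∀ x, P x

/-- `(M, S)` satisfies the scheme of `Σ⁰₂`-induction. -/
def Sigma02Induction (S : Set (Set M)) : Prop :=
  InductionFor (IsSigma02 S)

/-- `(M, S)` is a model of `RCA₀`: the basic axioms of arithmetic, `Σ⁰₁`-induction, and
`Δ⁰₁`-comprehension, the two schemes with arbitrary number and set parameters. -/
structure ModelsRCA0 (S : Set (Set M)) : Prop where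
  succ_ne_zero : ∀ m : M, m + 1 ≠ 0
  succ_inj : ∀ m n : M, m + 1 = n + 1 → m = n
  add_zero : ∀ m : M, m + 0 = m
  add_succ : ∀ m n : M, m + (n + 1) = (m + n) + 1
  mul_zero : ∀ m : M, m * 0 = 0
  mul_succ : ∀ m n : M, m * (n + 1) = m * n + m
  not_lt_zero : ∀ m : M, ¬ m < 0
  lt_succ_iff : ∀ m n : M, m < n + 1 ↔ m < n ∨ m = n
  sigma01_induction : InductionFor (IsSigma01 S)
  delta01_comprehension : ∀ P Q : M → Prop, IsSigma01 S P → IsPi01 S Q → (∀ x, P x ↔ Q x) →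
    ∃ A ∈ S, ∀ x, x ∈ A ↔ P x

/-- The usual code `(m + n)² + m` of the ordered pair of `m` and `n`. -/
def pair (m n : M) : M := (m + n) * (m + n) + m

/-- The `i`-th member `{m | (m, i) ∈ Z}` of the sequence of sets that is coded by `Z`. -/
def nth (Z : Set M) (i : M) : Set M := {m | pair m i ∈ Z}

/-- The set of pairs `F` is a function from `A` to `B`. -/
def IsFunction (F A B : Set M) : Prop :=
  (∀ p ∈ F, ∃ a ∈ A, ∃ b ∈ B, p = pair a b) ∧ ∀ a ∈ A, ∃! b, pair a b ∈ F

/-- An order is coded by its reflexive order relation, a set `L` of pairs; `le L a b` is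
`a ≤_L b`. -/
def le (L : Set M) (a b : M) : Prop := pair a b ∈ L

/-- `a <_L b`. -/
def lt (L : Set M) (a b : M) : Prop := le L a b ∧ a ≠ b

/-- The underlying set of the order that is coded by `L`. -/
def field (L : Set M) : Set M := {a | le L a a}

/-- `L` codes a (reflexive) linear order on a set of numbers, possibly finite or empty. -/
structure IsLinOrder (L : Set M) : Prop where
  refl : ∀ a b, le L a b → a ∈ field L ∧ b ∈ field L
  antisymm : ∀ a b, le L a b → le L b a → a = b
  trans : ∀ a b c, le L a b → le L b c → le L a c
  total : ∀ a ∈ field L, ∀ b ∈ field L, le L a b ∨ le L b a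

/-- `L` is a well order in the sense of `(M, S)`: a linear order for which `S` contains no
infinite descending sequence `f : ℕ → L`, where `ℕ` is the number domain `M`. -/
def IsWellOrder (S : Set (Set M)) (L : Set M) : Prop :=
  IsLinOrder L ∧
    ¬ ∃ F ∈ S, IsFunction F Set.univ (field L) ∧
      ∀ n a b : M, pair n a ∈ F → pair (n + 1) b ∈ F → lt L b a

/-- `S` contains an embedding, i.e. a strictly order preserving map, from `L` to `L'`. -/
def Embeds (S : Set (Set M)) (L L' : Set M) : Prop :=
  ∃ F ∈ S, IsFunction F (field L) (field L') ∧
    ∀ a a' b b' : M, pair a b ∈ F → pair a' b' ∈ F → lt L a a' → lt L' b b'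

/-- `(M, S)` satisfies `(WF2)`: every infinite sequence of well orders has two members
with different indices one of which embeds into the other. -/
def WF2 (S : Set (Set M)) : Prop :=
  ∀ Z ∈ S, (∀ i : M, IsWellOrder S (nth Z i)) →
    ∃ i j : M, i ≠ j ∧ Embeds S (nth Z i) (nth Z j)

end Semantics

end SecondOrderArithmetic

/-!
Suppose that induction fails for `∃ u, ∀ v, T v u x`: it holds at `0` and passes to successors, but
fails at `a`. Let `E x` be the set of all `r` such that for some `y ≤ x` no `u < r` is a witness.
This is an initial segment that increases with `x`, and it is uniformly `Σ⁰₁`. It has a greatest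
element if the `y ≤ x` have witnesses below a common bound, which happens for the `x` in a proper
cut below `a`; otherwise it is the whole number domain. The greatest elements are unbounded on the
cut.

The order `L i` is a sum of columns, two for each `y ≤ a`. Where `E y` has the greatest element `r`,
they have `(y + 1) * (r + 1) + min r i` elements in the first half of the sum and `r - i + 1` in the
second; where `E y` is everything, they have the order type of the number domain. By `Σ⁰₁`-induction
these sums are well orders. Suppose that `L i` embeds into `L j`, and compare the halves of `L i`
and `L j` in which the columns of `L i` are at least as long. No column moves up there: a column
just before one that does not move up can do so only if an infinite column fits into a proper
initial part of a column. A column that is strictly longer in `L i` has to move down, and then so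
does every earlier one, down to the first. The first halves rule this out for `j < i` and the second
halves, together with a shift of the first halves by one column, for `i < j`.
-/

namespace SecondOrderArithmetic

/-! ### Definability -/

section Definability

variable {M : Type*} [Zero M] [One M] [Add M] [Mul M]

/-- Functions of `n` numbers that are given by a term with number parameters. This and the next
class are generated by closure rules, so that definability can be checked by `constructor`. -/
inductive TermDefinable : (n : ℕ) → ((Fin n → M) → M) → Prop
  | const {n : ℕ} (c : M) : TermDefinable n fun _ => c
  | var {n : ℕ} (i : Fin n) : TermDefinable n fun v => v i
  | add {n : ℕ} {f g : (Fin n → M) → M} :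
      TermDefinable n f → TermDefinable n g → TermDefinable n fun v => f v + g v
  | mul {n : ℕ} {f g : (Fin n → M) → M} :
      TermDefinable n f → TermDefinable n g → TermDefinable n fun v => f v * g v

variable [LT M]

/-- Relations between `n` numbers that are given by a bounded formula with number parameters and
with set parameters from `S`. -/
inductive BddDefinable (S : Set (Set M)) : (n : ℕ) → ((Fin n → M) → Prop) → Prop
  | eq {n : ℕ} {f g : (Fin n → M) → M} :
      TermDefinable n f → TermDefinable n g → BddDefinable S n fun v => f v = g v
  | lt {n : ℕ} {f g : (Fin n → M) → M} :
      TermDefinable n f → TermDefinable n g → BddDefinable S n fun v => f v < g v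
  | mem {n : ℕ} {f : (Fin n → M) → M} {A : Set M} :
      A ∈ S → TermDefinable n f → BddDefinable S n fun v => f v ∈ A
  | not {n : ℕ} {P : (Fin n → M) → Prop} : BddDefinable S n P → BddDefinable S n fun v => ¬ P v
  | and {n : ℕ} {P Q : (Fin n → M) → Prop} :
      BddDefinable S n P → BddDefinable S n Q → BddDefinable S n fun v => P v ∧ Q v
  | or {n : ℕ} {P Q : (Fin n → M) → Prop} :
      BddDefinable S n P → BddDefinable S n Q → BddDefinable S n fun v => P v ∨ Q v
  | ball {n : ℕ} {t : (Fin n → M) → M} {P : (Fin n → M) → M → Prop} :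
      TermDefinable n t → BddDefinable S (n + 1) (fun w => P (Fin.tail w) (w 0)) →
      BddDefinable S n fun v => ∀ a < t v, P v a
  | bex {n : ℕ} {t : (Fin n → M) → M} {P : (Fin n → M) → M → Prop} :
      TermDefinable n t → BddDefinable S (n + 1) (fun w => P (Fin.tail w) (w 0)) →
      BddDefinable S n fun v => ∃ a < t v, P v a

/-- Renaming of the variables of a term along `f`. -/
def NumTerm.rename {n n' : ℕ} (f : Fin n → Fin n') : NumTerm n → NumTerm n'
  | .var i => .var (f i)
  | .zero => .zero
  | .one => .one
  | .add s t => .add (s.rename f) (t.rename f)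
  | .mul s t => .mul (s.rename f) (t.rename f)

/-- Renaming of the set variables of a formula along `g` and of its number variables along a
second map, which fixes the variable `0` when it passes a quantifier. -/
def BddFormula.rename {k k' : ℕ} (g : Fin k → Fin k') :
    {n n' : ℕ} → (Fin n → Fin n') → BddFormula k n → BddFormula k' n'
  | _, _, f, .eq s t => .eq (s.rename f) (t.rename f)
  | _, _, f, .lt s t => .lt (s.rename f) (t.rename f)
  | _, _, f, .mem t i => .mem (t.rename f) (g i)
  | _, _, f, .neg φ => .neg (φ.rename g f)
  | _, _, f, .and φ ψ => .and (φ.rename g f) (ψ.rename g f)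
  | _, _, f, .ball t φ => .ball (t.rename f) (φ.rename g (Fin.cons 0 fun i => (f i).succ))

omit [LT M] in
theorem NumTerm.eval_rename {n n' : ℕ} (f : Fin n → Fin n') (t : NumTerm n) (v : Fin n' → M) :
    (t.rename f).eval v = t.eval (v ∘ f) := by
  induction t with
  | var i => rfl
  | zero => rfl
  | one => rfl
  | add s t hs ht => simp only [rename, eval, hs, ht]
  | mul s t hs ht => simp only [rename, eval, hs, ht]

theorem BddFormula.sat_rename {k k' n n' : ℕ} (g : Fin k → Fin k') (X : Fin k' → Set M)
    (f : Fin n → Fin n') (φ : BddFormula k n) (v : Fin n' → M) :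
    (φ.rename g f).Sat X v ↔ φ.Sat (X ∘ g) (v ∘ f) := by
  induction φ generalizing n' with
  | eq s t => simp only [rename, Sat, NumTerm.eval_rename]
  | lt s t => simp only [rename, Sat, NumTerm.eval_rename]
  | mem t i => simp only [rename, Sat, NumTerm.eval_rename, Function.comp]
  | neg φ ih => simp only [rename, Sat, ih]
  | and φ ψ h₁ h₂ => simp only [rename, Sat, h₁, h₂]
  | ball t φ ih =>
    have cons_comp (a : M) : (Fin.cons a v : Fin (n' + 1) → M) ∘
        (Fin.cons 0 fun i => (f i).succ) = Fin.cons a (v ∘ f) := by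
      funext i
      cases i using Fin.cases <;> simp
    simp only [rename, Sat, NumTerm.eval_rename, ih, cons_comp]

/-- The assignment that gives to the variable `i` either one of the arguments `v` or a fixed
parameter, as prescribed by `e i`. -/
def assign {n N : ℕ} (e : Fin N → Fin n ⊕ M) (v : Fin n → M) (i : Fin N) : M :=
  Sum.elim v id (e i)

/-- `f` is the value of a term under an assignment of arguments and parameters. -/
def HasTerm {n : ℕ} (f : (Fin n → M) → M) : Prop :=
  ∃ (N : ℕ) (t : NumTerm N) (e : Fin N → Fin n ⊕ M), ∀ v, f v = t.eval (assign e v)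

/-- `P` is satisfaction of a bounded formula under an assignment of arguments and parameters. -/
def HasFormula (S : Set (Set M)) {n : ℕ} (P : (Fin n → M) → Prop) : Prop :=
  ∃ (k N : ℕ) (θ : BddFormula k N) (X : Fin k → Set M) (e : Fin N → Fin n ⊕ M),
    (∀ i, X i ∈ S) ∧ ∀ v, P v ↔ θ.Sat X (assign e v)

omit [Zero M] [One M] [Add M] [Mul M] [LT M] in
theorem assign_append_castAdd {n N₁ N₂ : ℕ} (e₁ : Fin N₁ → Fin n ⊕ M) (e₂ : Fin N₂ → Fin n ⊕ M)
    (v : Fin n → M) : assign (Fin.append e₁ e₂) v ∘ Fin.castAdd N₂ = assign e₁ v := by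
  funext i
  simp [assign]

omit [Zero M] [One M] [Add M] [Mul M] [LT M] in
theorem assign_append_natAdd {n N₁ N₂ : ℕ} (e₁ : Fin N₁ → Fin n ⊕ M) (e₂ : Fin N₂ → Fin n ⊕ M)
    (v : Fin n → M) : assign (Fin.append e₁ e₂) v ∘ Fin.natAdd N₁ = assign e₂ v := by
  funext i
  simp [assign]

omit [LT M] in
theorem HasTerm.exists_common_assign {n : ℕ} {f g : (Fin n → M) → M} (hf : HasTerm f)
    (hg : HasTerm g) :
    ∃ (N : ℕ) (s t : NumTerm N) (e : Fin N → Fin n ⊕ M),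
      (∀ v, f v = s.eval (assign e v)) ∧ ∀ v, g v = t.eval (assign e v) := by
  obtain ⟨N₁, s, e₁, hs⟩ := hf
  obtain ⟨N₂, t, e₂, ht⟩ := hg
  refine ⟨N₁ + N₂, s.rename (Fin.castAdd N₂), t.rename (Fin.natAdd N₁), Fin.append e₁ e₂,
    fun v => ?_, fun v => ?_⟩
  · rw [hs, NumTerm.eval_rename, assign_append_castAdd]
  · rw [ht, NumTerm.eval_rename, assign_append_natAdd]

omit [LT M] in
theorem TermDefinable.hasTerm {n : ℕ} {f : (Fin n → M) → M} (hf : TermDefinable n f) :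
    HasTerm f := by
  induction hf with
  | const c => exact ⟨1, .var 0, fun _ => .inr c, fun v => rfl⟩
  | var i => exact ⟨1, .var 0, fun _ => .inl i, fun v => rfl⟩
  | add _ _ hf hg =>
    obtain ⟨N, s, t, e, hs, ht⟩ := hf.exists_common_assign hg
    exact ⟨N, .add s t, e, fun v => congrArg₂ (· + ·) (hs v) (ht v)⟩
  | mul _ _ hf hg =>
    obtain ⟨N, s, t, e, hs, ht⟩ := hf.exists_common_assign hg
    exact ⟨N, .mul s t, e, fun v => congrArg₂ (· * ·) (hs v) (ht v)⟩

namespace HasFormula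

variable {S : Set (Set M)} {n : ℕ} {P Q : (Fin n → M) → Prop}

theorem congr (hP : HasFormula S P) (h : ∀ v, Q v ↔ P v) : HasFormula S Q := by
  rwa [show Q = P from funext fun v => propext (h v)]

theorem not (hP : HasFormula S P) : HasFormula S fun v => ¬ P v := by
  obtain ⟨k, N, θ, X, e, hX, h⟩ := hP
  exact ⟨k, N, .neg θ, X, e, hX, fun v => not_congr (h v)⟩

theorem and (hP : HasFormula S P) (hQ : HasFormula S Q) : HasFormula S fun v => P v ∧ Q v := by
  obtain ⟨k₁, N₁, θ₁, X₁, e₁, hX₁, h₁⟩ := hP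
  obtain ⟨k₂, N₂, θ₂, X₂, e₂, hX₂, h₂⟩ := hQ
  have comp_castAdd : Fin.append X₁ X₂ ∘ Fin.castAdd k₂ = X₁ := by funext i; simp
  have comp_natAdd : Fin.append X₁ X₂ ∘ Fin.natAdd k₁ = X₂ := by funext i; simp
  refine ⟨k₁ + k₂, N₁ + N₂, .and (θ₁.rename (Fin.castAdd k₂) (Fin.castAdd N₂))
    (θ₂.rename (Fin.natAdd k₁) (Fin.natAdd N₁)), Fin.append X₁ X₂, Fin.append e₁ e₂,
    fun i => ?_, fun v => ?_⟩
  · cases i using Fin.addCases with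
    | left j => simpa using hX₁ j
    | right j => simpa using hX₂ j
  · simp only [BddFormula.Sat, BddFormula.sat_rename, assign_append_castAdd,
      assign_append_natAdd, comp_castAdd, comp_natAdd, h₁, h₂]

theorem ball {t : (Fin n → M) → M} {P : (Fin n → M) → M → Prop} (ht : HasTerm t)
    (hP : HasFormula S fun w : Fin (n + 1) → M => P (Fin.tail w) (w 0)) :
    HasFormula S fun v => ∀ a < t v, P v a := by
  classical
  obtain ⟨N₁, s, e₁, hs⟩ := ht
  obtain ⟨k, N₂, θ, X, e₂, hX, h⟩ := hP
  -- The variables of `θ` that stand for the bound argument become the variable `0`.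
  let e : Fin N₂ → Fin n ⊕ M := fun i =>
    Sum.elim (Fin.cases (Sum.inr 0) fun j => Sum.inl j) Sum.inr (e₂ i)
  let f : Fin N₂ → Fin (N₁ + N₂ + 1) := fun i =>
    if e₂ i = .inl 0 then 0 else (Fin.natAdd N₁ i).succ
  have cons_comp (v : Fin n → M) (a : M) :
      (Fin.cons a (assign (Fin.append e₁ e) v) : Fin (N₁ + N₂ + 1) → M) ∘ f =
        assign e₂ (Fin.cons a v) := by
    funext i
    rcases hi : e₂ i with j | c
    · cases j using Fin.cases <;> simp [f, e, assign, hi]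
    · simp [f, e, assign, hi]
  refine ⟨k, N₁ + N₂, .ball (s.rename (Fin.castAdd N₂)) (θ.rename id f), X, Fin.append e₁ e, hX,
    fun v => ?_⟩
  simp only [BddFormula.Sat, BddFormula.sat_rename, NumTerm.eval_rename, assign_append_castAdd,
    ← hs, Function.comp_id, cons_comp, ← h, Fin.tail_cons, Fin.cons_zero]

end HasFormula

omit [LT M] in
theorem TermDefinable.eval {N n : ℕ} (t : NumTerm N) {e : (Fin n → M) → Fin N → M}
    (he : ∀ i, TermDefinable n fun v => e v i) : TermDefinable n fun v => t.eval (e v) := by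
  induction t with
  | var i => exact he i
  | zero => exact .const 0
  | one => exact .const 1
  | add s t hs ht => exact .add hs ht
  | mul s t hs ht => exact .mul hs ht

omit [Zero M] [One M] [LT M] in
theorem TermDefinable.tail {n : ℕ} {f : (Fin n → M) → M} (hf : TermDefinable n f) :
    TermDefinable (n + 1) fun w => f (Fin.tail w) := by
  induction hf with
  | const c => exact .const c
  | var i => exact .var i.succ
  | add _ _ hs ht => exact .add hs ht
  | mul _ _ hs ht => exact .mul hs ht

namespace BddDefinable

variable {S : Set (Set M)} {n : ℕ}

theorem hasFormula {P : (Fin n → M) → Prop} (hP : BddDefinable S n P) : HasFormula S P := by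
  induction hP with
  | eq hf hg =>
    obtain ⟨N, s, t, e, hs, ht⟩ := hf.hasTerm.exists_common_assign hg.hasTerm
    exact ⟨0, N, .eq s t, Fin.elim0, e, fun i => i.elim0, fun v =>
      iff_of_eq (congrArg₂ (· = ·) (hs v) (ht v))⟩
  | lt hf hg =>
    obtain ⟨N, s, t, e, hs, ht⟩ := hf.hasTerm.exists_common_assign hg.hasTerm
    exact ⟨0, N, .lt s t, Fin.elim0, e, fun i => i.elim0, fun v =>
      iff_of_eq (congrArg₂ (· < ·) (hs v) (ht v))⟩
  | @mem _ _ A hA hf =>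
    obtain ⟨N, s, e, hs⟩ := hf.hasTerm
    exact ⟨1, N, .mem s 0, fun _ => A, e, fun _ => hA, fun v => iff_of_eq (congrArg (· ∈ A) (hs v))⟩
  | not _ h => exact h.not
  | and _ _ hP hQ => exact hP.and hQ
  | or _ _ hP hQ => exact (hP.not.and hQ.not).not.congr fun v => or_iff_not_and_not
  | ball ht _ h => exact h.ball ht.hasTerm
  | @bex _ t P ht _ h =>
    exact (HasFormula.ball (P := fun v a => ¬ P v a) ht.hasTerm h.not).not.congr fun v => by
      push Not; rfl

theorem sat {k N : ℕ} (θ : BddFormula k N) {X : Fin k → Set M} (hX : ∀ i, X i ∈ S)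
    {e : (Fin n → M) → Fin N → M} (he : ∀ i, TermDefinable n fun v => e v i) :
    BddDefinable S n fun v => θ.Sat X (e v) := by
  induction θ generalizing n with
  | eq s t => exact .eq (.eval s he) (.eval t he)
  | lt s t => exact .lt (.eval s he) (.eval t he)
  | mem t i => exact .mem (hX i) (.eval t he)
  | neg φ ih => exact .not (ih he)
  | and φ ψ h₁ h₂ => exact .and (h₁ he) (h₂ he)
  | ball t φ ih =>
    exact .ball (P := fun v a => φ.Sat X (Fin.cons a (e v))) (.eval t he)
      (ih (Fin.cases (.var 0) fun i => (he i).tail))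

omit [Zero M] [One M] in
theorem congr {P Q : (Fin n → M) → Prop} (hP : BddDefinable S n P) (h : ∀ v, Q v ↔ P v) :
    BddDefinable S n Q := by
  rwa [show Q = P from funext fun v => propext (h v)]

theorem subst {m : ℕ} {P : (Fin m → M) → Prop} (hP : BddDefinable S m P)
    {f : (Fin n → M) → Fin m → M} (hf : ∀ i, TermDefinable n fun v => f v i) :
    BddDefinable S n fun v => P (f v) := by
  obtain ⟨k, N, θ, X, e, hX, h⟩ := hP.hasFormula
  refine (sat θ hX (e := fun v => assign e (f v)) fun i => ?_).congr fun v => h _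
  rcases hi : e i with j | c
  · simp only [assign, hi]
    exact hf j
  · simp only [assign, hi]
    exact .const c

theorem subst₃ {R : M → M → M → Prop} (hR : BddDefinable S 3 fun v => R (v 0) (v 1) (v 2))
    {f g k : (Fin n → M) → M} (hf : TermDefinable n f) (hg : TermDefinable n g)
    (hk : TermDefinable n k) : BddDefinable S n fun v => R (f v) (g v) (k v) :=
  hR.subst (f := fun v => ![f v, g v, k v]) fun i => by fin_cases i <;> assumption

theorem subst₄ {R : M → M → M → M → Prop}
    (hR : BddDefinable S 4 fun v => R (v 0) (v 1) (v 2) (v 3)) {f g k l : (Fin n → M) → M}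
    (hf : TermDefinable n f) (hg : TermDefinable n g) (hk : TermDefinable n k)
    (hl : TermDefinable n l) : BddDefinable S n fun v => R (f v) (g v) (k v) (l v) :=
  hR.subst (f := fun v => ![f v, g v, k v, l v]) fun i => by fin_cases i <;> assumption

theorem exists_formula {Q : (Fin 2 → M) → Prop} (hQ : BddDefinable S 2 Q) :
    ∃ (k n : ℕ) (θ : BddFormula k (n + 2)) (X : Fin k → Set M) (p : Fin n → M),
      (∀ i, X i ∈ S) ∧ ∀ u x, Q ![u, x] ↔ θ.Sat X (Fin.cons u (Fin.cons x p)) := by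
  obtain ⟨k, N, θ, X, e, hX, h⟩ := hQ.hasFormula
  let p : Fin N → M := fun i => Sum.elim (fun _ => 0) id (e i)
  let f : Fin N → Fin (N + 2) := fun i =>
    Sum.elim (Fin.castLE (by omega)) (fun _ => i.succ.succ) (e i)
  have assign_eq (u x : M) :
      assign e ![u, x] = (Fin.cons u (Fin.cons x p) : Fin (N + 2) → M) ∘ f := by
    funext i
    rcases hi : e i with j | c
    · simp only [assign, Function.comp, f, hi]
      fin_cases j <;> rfl
    · simp [assign, f, p, hi]
  refine ⟨k, N, θ.rename id f, X, p, hX, fun u x => ?_⟩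
  rw [h, BddFormula.sat_rename, Function.comp_id, assign_eq]

theorem isPi01 {P : M → Prop} (hP : BddDefinable S 1 fun v => P (v 0)) : IsPi01 S P := by
  have hQ : BddDefinable S 2 fun v => P (v 1) := hP.subst (f := fun v => ![v 1]) fun i => by
    fin_cases i; exact .var 1
  obtain ⟨k, n, θ, X, p, hX, h⟩ := hQ.exists_formula
  exact ⟨k, n, θ, X, p, hX, fun x =>
    ⟨fun hx u => (h u x).1 hx, fun hx => (h 0 x).2 (hx 0)⟩⟩

end BddDefinable

/-- Relations between `n` numbers that are given by a `Σ⁰₁` formula with parameters: a single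
existential quantifier over the variable `0` in front of a bounded relation. -/
def SigmaDefinable (S : Set (Set M)) (n : ℕ) (P : (Fin n → M) → Prop) : Prop :=
  ∃ Q : (Fin (n + 1) → M) → Prop, BddDefinable S (n + 1) Q ∧ ∀ v, P v ↔ ∃ u, Q (Fin.cons u v)

namespace SigmaDefinable

variable {S : Set (Set M)} {n : ℕ} {P Q : (Fin n → M) → Prop}

omit [Zero M] [One M] in
theorem exists_bdd {P : (Fin n → M) → M → Prop}
    (hP : BddDefinable S (n + 1) fun w => P (Fin.tail w) (w 0)) :
    SigmaDefinable S n fun v => ∃ u, P v u :=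
  ⟨_, hP, fun _ => Iff.rfl⟩

theorem bdd (hP : BddDefinable S n P) : SigmaDefinable S n P :=
  ⟨_, hP.subst (f := Fin.tail) fun i => .var i.succ, fun _ =>
    ⟨fun h => ⟨0, h⟩, fun ⟨_, h⟩ => h⟩⟩

omit [Zero M] [One M] in
theorem congr (hP : SigmaDefinable S n P) (h : ∀ v, Q v ↔ P v) : SigmaDefinable S n Q := by
  rwa [show Q = P from funext fun v => propext (h v)]

omit [Zero M] [One M] in
theorem or (hP : SigmaDefinable S n P) (hQ : SigmaDefinable S n Q) :
    SigmaDefinable S n fun v => P v ∨ Q v := by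
  obtain ⟨P', hP', hP⟩ := hP
  obtain ⟨Q', hQ', hQ⟩ := hQ
  exact ⟨_, hP'.or hQ', fun v => (or_congr (hP v) (hQ v)).trans exists_or.symm⟩

theorem subst {m : ℕ} (hP : SigmaDefinable S n P) {f : (Fin m → M) → Fin n → M}
    (hf : ∀ i, TermDefinable m fun v => f v i) : SigmaDefinable S m fun v => P (f v) := by
  obtain ⟨Q, hQ, h⟩ := hP
  exact (exists_bdd (P := fun v u => Q (Fin.cons u (f v)))
    (hQ.subst (Fin.cases (.var 0) fun i => (hf i).tail))).congr fun v => h _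

theorem subst₂ {R : M → M → Prop} (hR : SigmaDefinable S 2 fun v => R (v 0) (v 1))
    {f g : (Fin n → M) → M} (hf : TermDefinable n f) (hg : TermDefinable n g) :
    SigmaDefinable S n fun v => R (f v) (g v) :=
  hR.subst (f := fun v => ![f v, g v]) fun i => by fin_cases i <;> assumption

theorem subst₄ {R : M → M → M → M → Prop}
    (hR : SigmaDefinable S 4 fun v => R (v 0) (v 1) (v 2) (v 3)) {f g k l : (Fin n → M) → M}
    (hf : TermDefinable n f) (hg : TermDefinable n g) (hk : TermDefinable n k)
    (hl : TermDefinable n l) : SigmaDefinable S n fun v => R (f v) (g v) (k v) (l v) :=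
  hR.subst (f := fun v => ![f v, g v, k v, l v]) fun i => by fin_cases i <;> assumption

theorem isSigma01 {P : M → Prop} (hP : SigmaDefinable S 1 fun v => P (v 0)) : IsSigma01 S P := by
  obtain ⟨Q, hQ, h⟩ := hP
  obtain ⟨k, n, θ, X, p, hX, hθ⟩ := hQ.exists_formula
  exact ⟨k, n, θ, X, p, hX, fun x => (h ![x]).trans (exists_congr fun u => hθ u x)⟩

end SigmaDefinable

theorem IsSigma02.exists_bddDefinable {S : Set (Set M)} {P : M → Prop} (hP : IsSigma02 S P) :
    ∃ T : M → M → M → Prop, BddDefinable S 3 (fun v => T (v 0) (v 1) (v 2)) ∧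
      ∀ x, P x ↔ ∃ u, ∀ v, T v u x := by
  obtain ⟨k, n, θ, X, p, hX, h⟩ := hP
  refine ⟨_, .sat θ hX (e := fun v => Fin.cons (v 0) (Fin.cons (v 1) (Fin.cons (v 2) p))) ?_, h⟩
  exact Fin.cases (.var 0) (Fin.cases (.var 1) (Fin.cases (.var 2) fun i => .const (p i)))

end Definability

/-! ### Arithmetic in models of `RCA₀` -/

namespace ModelsRCA0

section Arithmetic

variable {M : Type*} [Zero M] [One M] [Add M] [Mul M] [LT M] {S : Set (Set M)}

theorem induction (h : ModelsRCA0 S) {P : M → Prop}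
    (definable : SigmaDefinable S 1 fun v => P (v 0)) (zero : P 0)
    (succ : ∀ x, P x → P (x + 1)) (x : M) : P x :=
  h.sigma01_induction P definable.isSigma01 zero succ x

theorem exists_set (h : ModelsRCA0 S) {P : M → Prop} (hP : BddDefinable S 1 fun v => P (v 0)) :
    ∃ A ∈ S, ∀ x, x ∈ A ↔ P x :=
  h.delta01_comprehension P P (SigmaDefinable.bdd hP).isSigma01 hP.isPi01 fun _ => Iff.rfl

protected theorem zero_add (h : ModelsRCA0 S) (x : M) : 0 + x = x := by
  induction x using h.induction with
  | definable => exact .bdd (by repeat' constructor)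
  | zero => exact h.add_zero 0
  | succ x ih => rw [h.add_succ, ih]

protected theorem succ_add (h : ModelsRCA0 S) (x y : M) : x + 1 + y = x + y + 1 := by
  induction y using h.induction with
  | definable => exact .bdd (by repeat' constructor)
  | zero => rw [h.add_zero, h.add_zero]
  | succ y ih => rw [h.add_succ, ih, h.add_succ]

protected theorem add_comm (h : ModelsRCA0 S) (x y : M) : x + y = y + x := by
  induction y using h.induction with
  | definable => exact .bdd (by repeat' constructor)
  | zero => rw [h.add_zero, h.zero_add]
  | succ y ih => rw [h.add_succ, ih, h.succ_add]

protected theorem add_assoc (h : ModelsRCA0 S) (x y z : M) : x + y + z = x + (y + z) := by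
  induction z using h.induction with
  | definable => exact .bdd (by repeat' constructor)
  | zero => rw [h.add_zero, h.add_zero]
  | succ z ih => rw [h.add_succ, ih, h.add_succ, h.add_succ]

protected theorem mul_add (h : ModelsRCA0 S) (x y z : M) : x * (y + z) = x * y + x * z := by
  induction z using h.induction with
  | definable => exact .bdd (by repeat' constructor)
  | zero => rw [h.add_zero, h.mul_zero, h.add_zero]
  | succ z ih => rw [h.add_succ, h.mul_succ, ih, h.mul_succ, h.add_assoc]

protected theorem zero_mul (h : ModelsRCA0 S) (x : M) : 0 * x = 0 := by
  induction x using h.induction with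
  | definable => exact .bdd (by repeat' constructor)
  | zero => exact h.mul_zero 0
  | succ x ih => rw [h.mul_succ, ih, h.add_zero]

protected theorem add_right_comm (h : ModelsRCA0 S) (x y z : M) : x + y + z = x + z + y := by
  rw [h.add_assoc, h.add_comm y, ← h.add_assoc]

protected theorem succ_mul (h : ModelsRCA0 S) (x y : M) : (x + 1) * y = x * y + y := by
  induction y using h.induction with
  | definable => exact .bdd (by repeat' constructor)
  | zero => rw [h.mul_zero, h.mul_zero, h.add_zero]
  | succ y ih =>
    rw [h.mul_succ, ih, h.mul_succ, h.add_succ, h.add_succ, h.add_right_comm (x * y) y x]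

protected theorem mul_comm (h : ModelsRCA0 S) (x y : M) : x * y = y * x := by
  induction y using h.induction with
  | definable => exact .bdd (by repeat' constructor)
  | zero => rw [h.mul_zero, h.zero_mul]
  | succ y ih => rw [h.mul_succ, ih, h.succ_mul]

protected theorem mul_assoc (h : ModelsRCA0 S) (x y z : M) : x * y * z = x * (y * z) := by
  induction z using h.induction with
  | definable => exact .bdd (by repeat' constructor)
  | zero => rw [h.mul_zero, h.mul_zero, h.mul_zero]
  | succ z ih => rw [h.mul_succ, ih, h.mul_succ, h.mul_add]

protected theorem mul_one (h : ModelsRCA0 S) (x : M) : x * 1 = x := by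
  rw [← h.zero_add 1, h.mul_succ, h.mul_zero, h.zero_add]

theorem eq_zero_or_exists_eq_succ (h : ModelsRCA0 S) (x : M) : x = 0 ∨ ∃ y, x = y + 1 := by
  induction x using h.induction with
  | definable =>
    exact .or (.bdd (by repeat' constructor))
      (.exists_bdd (P := fun v y => v 0 = y + 1) (by repeat' constructor))
  | zero => exact .inl rfl
  | succ x => exact .inr ⟨x, rfl⟩

protected theorem add_right_cancel (h : ModelsRCA0 S) (a b c : M) (hc : a + c = b + c) :
    a = b := by
  have cancel : ¬ a + c = b + c ∨ a = b := by
    clear hc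
    induction c using h.induction with
    | definable => exact .bdd (by repeat' constructor)
    | zero => rw [h.add_zero, h.add_zero]; exact (em _).symm
    | succ c ih =>
      rw [h.add_succ, h.add_succ]
      exact ih.imp_left (mt (h.succ_inj _ _))
  exact cancel.resolve_left (not_not.2 hc)

theorem lt_add_succ (h : ModelsRCA0 S) (a c : M) : a < a + (c + 1) := by
  induction c using h.induction with
  | definable => exact .bdd (by repeat' constructor)
  | zero => rw [h.add_succ, h.add_zero, h.lt_succ_iff]; exact .inr rfl
  | succ c ih => rw [h.add_succ, h.lt_succ_iff]; exact .inl ih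

theorem lt_iff_exists_add_succ (h : ModelsRCA0 S) (a b : M) : a < b ↔ ∃ c, b = a + (c + 1) := by
  refine ⟨fun hab => ?_, fun ⟨c, hc⟩ => hc ▸ h.lt_add_succ a c⟩
  have lt_or : ¬ a < b ∨ ∃ c, b = a + (c + 1) := by
    clear hab
    induction b using h.induction with
    | definable =>
      exact .or (.bdd (by repeat' constructor))
        (.exists_bdd (P := fun v c => v 0 = a + (c + 1)) (by repeat' constructor))
    | zero => exact .inl (h.not_lt_zero a)
    | succ b ih =>
      refine or_iff_not_imp_left.2 fun hab => ?_
      rcases (h.lt_succ_iff _ _).1 (not_not.1 hab) with hab | rfl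
      · obtain ⟨c, rfl⟩ := ih.resolve_left (not_not.2 hab)
        exact ⟨c + 1, by rw [h.add_succ a (c + 1)]⟩
      · exact ⟨0, by rw [h.zero_add]⟩
  exact lt_or.resolve_left (not_not.2 hab)

protected theorem lt_irrefl (h : ModelsRCA0 S) (a : M) : ¬ a < a := by
  rw [h.lt_iff_exists_add_succ]
  rintro ⟨c, hc⟩
  refine h.succ_ne_zero c (h.add_right_cancel _ _ a ?_)
  rw [h.add_comm, ← hc, h.zero_add]

protected theorem lt_trans (h : ModelsRCA0 S) {a b c : M} (hab : a < b) (hbc : b < c) :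
    a < c := by
  rw [h.lt_iff_exists_add_succ] at *
  obtain ⟨x, rfl⟩ := hab
  obtain ⟨y, rfl⟩ := hbc
  exact ⟨x + 1 + y, by rw [h.add_assoc, h.add_succ (x + 1)]⟩

protected theorem lt_trichotomy (h : ModelsRCA0 S) (a b : M) : a < b ∨ a = b ∨ b < a := by
  induction b using h.induction with
  | definable => exact .bdd (by repeat' constructor)
  | zero =>
    rcases h.eq_zero_or_exists_eq_succ a with rfl | ⟨y, rfl⟩
    · exact .inr (.inl rfl)
    · exact .inr (.inr ((h.lt_iff_exists_add_succ _ _).2 ⟨y, by rw [h.zero_add]⟩))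
  | succ b ih =>
    rcases ih with hab | rfl | hba
    · exact .inl ((h.lt_succ_iff _ _).2 (.inl hab))
    · exact .inl ((h.lt_succ_iff _ _).2 (.inr rfl))
    · obtain ⟨c, rfl⟩ := (h.lt_iff_exists_add_succ _ _).1 hba
      rcases h.eq_zero_or_exists_eq_succ c with rfl | ⟨d, rfl⟩
      · exact .inr (.inl (by rw [h.zero_add]))
      · exact .inr (.inr ((h.lt_iff_exists_add_succ _ _).2
          ⟨d, by rw [h.add_succ b, h.succ_add]⟩))

protected theorem add_lt_add_left (h : ModelsRCA0 S) {a b : M} (hab : a < b) (c : M) :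
    c + a < c + b := by
  rw [h.lt_iff_exists_add_succ] at *
  obtain ⟨x, rfl⟩ := hab
  exact ⟨x, by rw [h.add_assoc]⟩

protected theorem mul_lt_mul_left (h : ModelsRCA0 S) {a b c : M} (hab : a < b) (hc : 0 < c) :
    c * a < c * b := by
  rw [h.lt_iff_exists_add_succ] at *
  obtain ⟨x, rfl⟩ := hab
  obtain ⟨y, rfl⟩ := hc
  exact ⟨(y + 1) * x + y, by
    rw [h.zero_add, h.mul_add, h.mul_succ, h.add_succ ((y + 1) * x)]⟩

/-- The number domain of a model of `RCA₀` as a commutative semiring, so that the algebra of the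
library applies to it. -/
abbrev commSemiring (h : ModelsRCA0 S) : CommSemiring M where
  add_assoc := h.add_assoc
  zero_add := h.zero_add
  add_zero := h.add_zero
  add_comm := h.add_comm
  left_distrib := h.mul_add
  right_distrib a b c := by rw [h.mul_comm, h.mul_add, h.mul_comm c, h.mul_comm c]
  zero_mul := h.zero_mul
  mul_zero := h.mul_zero
  mul_assoc := h.mul_assoc
  one_mul a := by rw [h.mul_comm, h.mul_one]
  mul_one := h.mul_one
  mul_comm := h.mul_comm
  nsmul := nsmulRec

open Classical in
/-- The linear order on the number domain of a model of `RCA₀` with the given strict order. -/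
noncomputable abbrev linearOrder (h : ModelsRCA0 S) : LinearOrder M :=
  have : IsStrictTotalOrder M (· < ·) :=
    { irrefl := h.lt_irrefl
      trans := fun _ _ _ => h.lt_trans
      trichotomous := fun a b hab hba =>
        ((h.lt_trichotomy a b).resolve_left hab).resolve_right hba }
  linearOrderOfSTO (· < ·)

theorem isStrictOrderedRing (h : ModelsRCA0 S) :
    letI := h.commSemiring
    letI := h.linearOrder
    IsStrictOrderedRing M := by
  let := h.commSemiring
  let := h.linearOrder
  have : IsOrderedCancelAddMonoid M :=
    .of_add_lt_add_left fun c _ _ hab => h.add_lt_add_left hab c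
  have zero_lt_one : (0 : M) < 1 := by simpa only [zero_add] using h.lt_add_succ 0 0
  exact
    { zero_le_one := zero_lt_one.le
      exists_pair_ne := ⟨0, 1, zero_lt_one.ne⟩
      mul_lt_mul_of_pos_left := fun c hc a b hab => h.mul_lt_mul_left hab hc
      mul_lt_mul_of_pos_right := fun c hc a b hab => by
        rw [mul_comm a, mul_comm b]
        exact h.mul_lt_mul_left hab hc }

theorem canonicallyOrderedAdd (h : ModelsRCA0 S) :
    letI := h.commSemiring
    letI := h.linearOrder
    CanonicallyOrderedAdd M := by
  let := h.commSemiring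
  let := h.linearOrder
  have := h.isStrictOrderedRing
  have zero_le (a : M) : 0 ≤ a := not_lt.1 (h.not_lt_zero a)
  exact
    { le_self_add := fun a b => le_add_of_nonneg_right (zero_le b)
      le_add_self := fun a b => le_add_of_nonneg_left (zero_le b)
      exists_add_of_le := fun {a b} hab => by
        rcases hab.lt_or_eq with hab | rfl
        · exact ((h.lt_iff_exists_add_succ a b).1 hab).imp' (· + 1) fun _ => id
        · exact ⟨0, (h.add_zero a).symm⟩ }

end Arithmetic

end ModelsRCA0

/-! ### Consequences of `Σ⁰₁`-induction -/

section Order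

variable {M : Type*} [CommSemiring M] [LinearOrder M] {S : Set (Set M)} {n : ℕ}

namespace BddDefinable

theorem le {f g : (Fin n → M) → M} (hf : TermDefinable n f) (hg : TermDefinable n g) :
    BddDefinable S n fun v => f v ≤ g v :=
  (BddDefinable.lt hg hf).not.congr fun _ => not_lt.symm

theorem toLex_le {f g k l : (Fin n → M) → M} (hf : TermDefinable n f) (hg : TermDefinable n g)
    (hk : TermDefinable n k) (hl : TermDefinable n l) :
    BddDefinable S n fun v => toLex (f v, g v) ≤ toLex (k v, l v) :=
  ((BddDefinable.lt hf hk).or (.and (.eq hf hk) (.le hg hl))).congr fun _ =>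
    Prod.Lex.toLex_le_toLex

end BddDefinable

namespace ModelsRCA0

variable {P : M → Prop}

theorem lt_add_one_iff (h : ModelsRCA0 S) {x y : M} : x < y + 1 ↔ x ≤ y :=
  (h.lt_succ_iff x y).trans le_iff_lt_or_eq.symm

theorem add_one_le_iff (h : ModelsRCA0 S) {x y : M} : x + 1 ≤ y ↔ x < y := by
  rw [← not_lt, h.lt_add_one_iff, not_le]

theorem toLex_add_one_le_iff (h : ModelsRCA0 S) {y t z s : M} :
    toLex (y, t + 1) ≤ toLex (z, s) ↔ toLex (y, t) < toLex (z, s) := by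
  rw [Prod.Lex.toLex_le_toLex, Prod.Lex.toLex_lt_toLex, h.add_one_le_iff]

theorem induction_le (h : ModelsRCA0 S) (hP : SigmaDefinable S 1 fun v => P (v 0)) {a : M}
    (zero : P 0) (succ : ∀ x < a, P x → P (x + 1)) {x : M} (hx : x ≤ a) : P x := by
  have lt_or : a < x ∨ P x := by
    clear hx
    induction x using h.induction with
    | definable => exact .or (.bdd (by repeat' constructor)) hP
    | zero => exact .inr zero
    | succ x ih =>
      rcases ih with hlt | hPx
      · exact .inl (hlt.trans (h.lt_add_one_iff.2 le_rfl))
      · exact (le_or_gt a x).imp h.lt_add_one_iff.2 fun hlt => succ x hlt hPx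
  exact lt_or.resolve_left hx.not_gt

end ModelsRCA0

variable [IsStrictOrderedRing M] [CanonicallyOrderedAdd M]

namespace SigmaDefinable

theorem ex {P : (Fin n → M) → M → Prop}
    (hP : SigmaDefinable S (n + 1) fun w => P (Fin.tail w) (w 0)) :
    SigmaDefinable S n fun v => ∃ a, P v a := by
  obtain ⟨Q, hQ, h⟩ := hP
  have hbdd : BddDefinable S (n + 1) fun w =>
      ∃ a < w 0, ∃ u < w 0, Q (Fin.cons u (Fin.cons a (Fin.tail w))) :=
    .bex (P := fun w a => ∃ u < w 0, Q (Fin.cons u (Fin.cons a (Fin.tail w)))) (.var 0) <|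
      .bex (P := fun w u => Q (Fin.cons u (Fin.cons (w 0) (Fin.tail (Fin.tail w))))) (.var 1) <|
        hQ.subst (Fin.cases (.var 0) (Fin.cases (.var 1) fun i => .var i.succ.succ.succ))
  refine (exists_bdd
    (P := fun v b => ∃ a < b, ∃ u < b, Q (Fin.cons u (Fin.cons a v))) hbdd).congr fun v => ?_
  have h' (a : M) : P v a ↔ ∃ u, Q (Fin.cons u (Fin.cons a v)) := h (Fin.cons a v)
  simp only [h']
  constructor
  · rintro ⟨a, u, hQ⟩
    exact ⟨a + u + 1, a, le_self_add.trans_lt (lt_add_one _), u,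
      le_add_self.trans_lt (lt_add_one _), hQ⟩
  · rintro ⟨-, a, -, u, -, hQ⟩
    exact ⟨a, u, hQ⟩

theorem and {P Q : (Fin n → M) → Prop} (hP : SigmaDefinable S n P) (hQ : SigmaDefinable S n Q) :
    SigmaDefinable S n fun v => P v ∧ Q v := by
  obtain ⟨P', hP', hP⟩ := hP
  obtain ⟨Q', hQ', hQ⟩ := hQ
  have hPQ : BddDefinable S (n + 1 + 1) fun w =>
      P' (Fin.cons (w 1) (Fin.tail (Fin.tail w))) ∧ Q' (Fin.cons (w 0) (Fin.tail (Fin.tail w))) :=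
    (hP'.subst (Fin.cases (.var 1) fun i => .var i.succ.succ)).and
      (hQ'.subst (Fin.cases (.var 0) fun i => .var i.succ.succ))
  refine (SigmaDefinable.ex (exists_bdd
    (P := fun w b => P' (Fin.cons (w 0) (Fin.tail w)) ∧ Q' (Fin.cons b (Fin.tail w)))
    hPQ) (P := fun v a => ∃ b, P' (Fin.cons a v) ∧ Q' (Fin.cons b v))).congr fun v => ?_
  rw [hP, hQ, exists_and_exists_comm]

end SigmaDefinable

namespace ModelsRCA0

variable {P : M → Prop}

theorem exists_least (h : ModelsRCA0 S) (hP : SigmaDefinable S 1 fun v => P (v 0))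
    (hex : ∃ x, P x) : ∃ x, P x ∧ ∀ y, P y → x ≤ y := by
  by_contra! hleast
  obtain ⟨a, ha⟩ := hex
  -- Counting down from `a`: for every `z` there is an instance that is at most `a - z`.
  have descend (z : M) : ∃ y, y + z ≤ a ∧ P y := by
    induction z using h.induction with
    | definable =>
      exact .ex (P := fun v y => y + v 0 ≤ a ∧ P y) (.and (.bdd (.le (.add (.var 0) (.var 1))
        (.const a))) (hP.subst (f := fun w => ![w 0]) (by simpa using .var 0)))
    | zero => exact ⟨a, by simp, ha⟩
    | succ z ih =>
      obtain ⟨y, hy, hPy⟩ := ih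
      obtain ⟨y', hPy', hy'⟩ := hleast y hPy
      refine ⟨y', ?_, hPy'⟩
      calc y' + (z + 1) = y' + 1 + z := by ring
        _ ≤ y + z := by gcongr; exact h.add_one_le_iff.2 hy'
        _ ≤ a := hy
  obtain ⟨y, hy, -⟩ := descend (a + 1)
  exact (h.add_one_le_iff.1 (le_add_self.trans hy)).false

theorem exists_greatest (h : ModelsRCA0 S) (hP : SigmaDefinable S 1 fun v => P (v 0))
    (hex : ∃ x, P x) {b : M} (hb : ∀ x, P x → x ≤ b) : ∃ x, P x ∧ ∀ y, P y → y ≤ x := by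
  by_contra! hgreatest
  have ascend (z : M) : ∃ y, z ≤ y ∧ P y := by
    induction z using h.induction with
    | definable =>
      exact .ex (P := fun v y => v 0 ≤ y ∧ P y) (.and (.bdd (.le (.var 1) (.var 0)))
        (hP.subst (f := fun w => ![w 0]) (by simpa using .var 0)))
    | zero => exact hex.imp fun x hx => ⟨zero_le, hx⟩
    | succ z ih =>
      obtain ⟨y, hy, hPy⟩ := ih
      obtain ⟨y', hPy', hy'⟩ := hgreatest y hPy
      exact ⟨y', h.add_one_le_iff.2 (hy.trans_lt hy'), hPy'⟩
  obtain ⟨y, hy, hPy⟩ := ascend (b + 1)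
  exact (h.add_one_le_iff.1 hy).not_ge (hb y hPy)

theorem exists_least_toLex (h : ModelsRCA0 S) {P : M → M → Prop}
    (hP : SigmaDefinable S 2 fun v => P (v 0) (v 1)) (hex : ∃ y t, P y t) :
    ∃ y t, P y t ∧ ∀ z s, P z s → toLex (y, t) ≤ toLex (z, s) := by
  obtain ⟨y, hy, hy_le⟩ := h.exists_least (P := fun y => ∃ t, P y t)
    (.ex (P := fun v t => P (v 0) t) (hP.subst (f := fun w => ![w 1, w 0])
      (by simpa [Fin.forall_fin_two] using ⟨.var 1, .var 0⟩))) hex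
  obtain ⟨t, ht, ht_le⟩ := h.exists_least (P := fun t => P y t)
    (hP.subst₂ (.const y) (.var 0)) hy
  refine ⟨y, t, ht, fun z s hzs => Prod.Lex.toLex_le_toLex.2 ?_⟩
  rcases (hy_le z ⟨s, hzs⟩).lt_or_eq with hlt | rfl
  · exact .inl hlt
  · exact .inr ⟨rfl, ht_le s hzs⟩

theorem exists_bound (h : ModelsRCA0 S) {R : M → M → Prop}
    (hR : BddDefinable S 2 fun v => R (v 0) (v 1)) {t : M} (hex : ∀ a < t, ∃ u, R a u) :
    ∃ b, ∀ a < t, ∃ u < b, R a u := by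
  refine h.induction_le (P := fun x => ∃ b, ∀ a < x, ∃ u < b, R a u) ?_
    ⟨0, by simp⟩ (fun x hx ih => ?_) le_rfl
  · refine .exists_bdd (P := fun v b => ∀ a < v 0, ∃ u < b, R a u) <|
      .ball (P := fun w a => ∃ u < w 0, R a u) (.var 1) <|
      .bex (P := fun w u => R (w 0) u) (.var 1) <| hR.subst (f := fun w => ![w 1, w 0]) ?_
    simpa [Fin.forall_fin_two] using ⟨.var 1, .var 0⟩
  · obtain ⟨b, hb⟩ := ih
    obtain ⟨u, hu⟩ := hex x hx
    refine ⟨b + u + 1, fun a ha => ?_⟩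
    rcases (h.lt_add_one_iff.1 ha).lt_or_eq with ha | rfl
    · obtain ⟨u', hu', hR⟩ := hb a ha
      exact ⟨u', hu'.trans_le (by rw [add_assoc]; exact le_self_add), hR⟩
    · exact ⟨u, h.lt_add_one_iff.2 le_add_self, hu⟩

end ModelsRCA0

namespace SigmaDefinable

theorem ball (h : ModelsRCA0 S) {t : (Fin n → M) → M} {P : (Fin n → M) → M → Prop}
    (ht : TermDefinable n t) (hP : SigmaDefinable S (n + 1) fun w => P (Fin.tail w) (w 0)) :
    SigmaDefinable S n fun v => ∀ a < t v, P v a := by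
  obtain ⟨Q, hQ, hPQ⟩ := hP
  have hbdd : BddDefinable S (n + 1) fun w =>
      ∀ a < t (Fin.tail w), ∃ u < w 0, Q (Fin.cons u (Fin.cons a (Fin.tail w))) :=
    .ball (P := fun w a => ∃ u < w 0, Q (Fin.cons u (Fin.cons a (Fin.tail w)))) ht.tail <|
      .bex (P := fun w u => Q (Fin.cons u (Fin.cons (w 0) (Fin.tail (Fin.tail w))))) (.var 1) <|
        hQ.subst (Fin.cases (.var 0) (Fin.cases (.var 1) fun i => .var i.succ.succ.succ))
  refine (exists_bdd (P := fun v b => ∀ a < t v, ∃ u < b, Q (Fin.cons u (Fin.cons a v)))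
    hbdd).congr fun v => ?_
  have hPQ' (a : M) : P v a ↔ ∃ u, Q (Fin.cons u (Fin.cons a v)) := hPQ (Fin.cons a v)
  simp only [hPQ']
  refine ⟨h.exists_bound (R := fun a u => Q (Fin.cons u (Fin.cons a v))) ?_,
    fun ⟨b, hb⟩ a ha => (hb a ha).imp fun u hu => hu.2⟩
  exact hQ.subst (Fin.cases (.var 1) (Fin.cases (.var 0) fun i => .const (v i)))

theorem exists_unique_witness (h : ModelsRCA0 S) {P : (Fin n → M) → Prop}
    (hP : SigmaDefinable S n P) :
    ∃ Q : (Fin (n + 1) → M) → Prop, BddDefinable S (n + 1) Q ∧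
      (∀ v, P v ↔ ∃ u, Q (Fin.cons u v)) ∧
      ∀ v u u', Q (Fin.cons u v) → Q (Fin.cons u' v) → u = u' := by
  obtain ⟨Q, hQ, hPQ⟩ := hP
  refine ⟨fun w => Q w ∧ ∀ u < w 0, ¬ Q (Fin.cons u (Fin.tail w)),
    hQ.and (.ball (P := fun w u => ¬ Q (Fin.cons u (Fin.tail w))) (.var 0)
      (hQ.subst (Fin.cases (.var 0) fun i => .var i.succ.succ)).not), fun v => ?_,
    fun v u u' hu hu' => ?_⟩
  · rw [hPQ]
    refine ⟨fun hex => ?_, fun ⟨u, hu⟩ => ⟨u, hu.1⟩⟩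
    obtain ⟨u, hu, hle⟩ := h.exists_least (P := fun u => Q (Fin.cons u v))
      (.bdd (hQ.subst (Fin.cases (.var 0) fun i => .const (v i)))) hex
    exact ⟨u, hu, fun u' hu' hQ' => hu'.not_ge (hle u' hQ')⟩
  · exact le_antisymm (not_lt.1 fun hlt => hu.2 _ hlt hu'.1)
      (not_lt.1 fun hlt => hu'.2 _ hlt hu.1)

end SigmaDefinable

end Order

/-! ### Increasing maps between lexicographic sums of columns -/

section ColumnMap

variable {M : Type*} [CommSemiring M] [LinearOrder M] {S : Set (Set M)} {C C' : M → M → Prop}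
  {G : M → M → M → M → Prop}

/-- `G` is the graph of a strictly increasing map from the pairs `(y, t)` with `C y t` to the
pairs `(y, t)` with `C' y t`, both in the lexicographic order. The columns `C y` and `C' y` are
initial segments. -/
structure IsColumnMap (S : Set (Set M)) (C C' : M → M → Prop) (G : M → M → M → M → Prop) :
    Prop where
  sigma : SigmaDefinable S 4 fun v => G (v 0) (v 1) (v 2) (v 3)
  down : ∀ {y s t}, C y t → s ≤ t → C y s
  down' : ∀ {y s t}, C' y t → s ≤ t → C' y s
  total : ∀ {y t}, C y t → ∃ z u, G y t z u
  cod : ∀ {y t z u}, G y t z u → C' z u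
  mono : ∀ {y t z u y₁ t₁ z₁ u₁}, G y t z u → G y₁ t₁ z₁ u₁ →
    toLex (y, t) < toLex (y₁, t₁) → toLex (z, u) < toLex (z₁, u₁)

/-- The columns of `C` dominate those of `C'` on the interval `[w, T]`, in the sense that a column
map from `C` to `C'` whose last column in the interval does not move up moves no column of the
interval up. -/
structure Dominates (C C' : M → M → Prop) (w T : M) : Prop where
  zero : ∀ {y}, w ≤ y → y ≤ T → C y 0
  subset : ∀ {y s}, w ≤ y → y ≤ T → C' y s → C y s
  univ_of_succ : ∀ {y}, w ≤ y → y < T → (∀ s, C' (y + 1) s) → ∀ s, C y s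

/-- The columns of `C`, each moved up by one; the column `0` becomes empty. -/
def ShiftedColumn (C : M → M → Prop) (y t : M) : Prop := ∃ z, y = z + 1 ∧ C z t

variable [IsStrictOrderedRing M] [CanonicallyOrderedAdd M]

omit [IsStrictOrderedRing M] [CanonicallyOrderedAdd M] in
theorem Dominates.of_univ {w T : M} (hC : ∀ y, w ≤ y → y ≤ T → ∀ s, C y s) :
    Dominates C C' w T where
  zero hwy hyT := hC _ hwy hyT 0
  subset hwy hyT _ := hC _ hwy hyT _
  univ_of_succ hwy hyT _ := hC _ hwy hyT.le

namespace IsColumnMap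

omit [IsStrictOrderedRing M] [CanonicallyOrderedAdd M] in
theorem fst_le (hG : IsColumnMap S C C' G) {y t z u y₁ t₁ z₁ u₁ : M} (hg : G y t z u)
    (hg₁ : G y₁ t₁ z₁ u₁) (hy : y < y₁) : z ≤ z₁ :=
  Prod.Lex.monotone_fst _ _ (hG.mono hg hg₁ (Prod.Lex.toLex_lt_toLex.2 (.inl hy))).le

theorem shift (hG : IsColumnMap S C C' G) :
    IsColumnMap S C (ShiftedColumn C') fun y t z u => ∃ z', z = z' + 1 ∧ G y t z' u where
  sigma := .ex (P := fun v z' => v 2 = z' + 1 ∧ G (v 0) (v 1) z' (v 3)) <| .and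
    (.bdd (.eq (.var 3) (.add (.var 0) (.const 1))))
    (hG.sigma.subst₄ (.var 1) (.var 2) (.var 0) (.var 4))
  down := hG.down
  down' := fun ⟨z, hz, hC⟩ hs => ⟨z, hz, hG.down' hC hs⟩
  total hC :=
    let ⟨z, u, hg⟩ := hG.total hC
    ⟨z + 1, u, z, rfl, hg⟩
  cod := fun ⟨z, hz, hg⟩ => ⟨z, hz, hG.cod hg⟩
  mono := by
    rintro y t _ u y₁ t₁ _ u₁ ⟨z, rfl, hg⟩ ⟨z₁, rfl, hg₁⟩ hlt
    simpa [Prod.Lex.toLex_lt_toLex] using hG.mono hg hg₁ hlt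

variable (h : ModelsRCA0 S) (hG : IsColumnMap S C C' G)
include h hG

theorem exists_add_le {y t z u s : M} (hg : G y t z u) (hC : C y (t + s)) :
    ∃ z₁ u₁, G y (t + s) z₁ u₁ ∧ toLex (z, u + s) ≤ toLex (z₁, u₁) := by
  refine h.induction_le
    (P := fun s => ∃ z₁ u₁, G y (t + s) z₁ u₁ ∧ toLex (z, u + s) ≤ toLex (z₁, u₁))
    (.ex (.ex (.and (hG.sigma.subst₄ (.const y) (.add (.const t) (.var 2)) (.var 1) (.var 0))
      (.bdd (.toLex_le (.const z) (.add (.const u) (.var 2)) (.var 1) (.var 0))))))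
    ⟨z, u, by simpa using hg, by simp⟩ ?_ le_rfl
  rintro r hr ⟨z₁, u₁, hg₁, hle⟩
  have hCr : C y (t + (r + 1)) := hG.down hC (add_le_add le_rfl (h.add_one_le_iff.2 hr))
  obtain ⟨z₂, u₂, hg₂⟩ := hG.total hCr
  have step : toLex (z₁, u₁) < toLex (z₂, u₂) := hG.mono hg₁ hg₂ <|
    Prod.Lex.toLex_lt_toLex.2 (.inr ⟨rfl, add_lt_add_of_le_of_lt le_rfl (lt_add_one r)⟩)
  refine ⟨z₂, u₂, hg₂, ?_⟩
  rw [← add_assoc, h.toLex_add_one_le_iff]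
  exact hle.trans_lt step

/-- Otherwise the next `u₁` points of the column `y` would not fit below `(z₁, u₁)`. -/
theorem fst_lt {y t z u y₁ t₁ z₁ u₁ : M} (hg : G y t z u) (hg₁ : G y₁ t₁ z₁ u₁) (hy : y < y₁)
    (hC : C y (t + u₁)) : z < z₁ := by
  obtain ⟨z₂, u₂, hg₂, hle⟩ := hG.exists_add_le h hg hC
  have hlt : toLex (z, u + u₁) < toLex (z₁, u₁) :=
    hle.trans_lt (hG.mono hg₂ hg₁ (Prod.Lex.toLex_lt_toLex.2 (.inl hy)))
  exact (Prod.Lex.toLex_lt_toLex.1 hlt).resolve_right fun hlt => hlt.2.not_ge le_add_self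

theorem univ_of_image_self {y u : M} (hle : ∀ {s z u}, G y s z u → z ≤ y)
    (hsub : ∀ {s}, C' y s → C y s) (hg : G y 0 y u) (hu : 0 < u) (s : M) : C' y s := by
  have unbounded : ∃ r u', G y r y u' ∧ s ≤ u' := by
    induction s using h.induction with
    | definable =>
      exact .ex (.ex (.and (hG.sigma.subst₄ (.const y) (.var 1) (.const y) (.var 0))
        (.bdd (.le (.var 2) (.var 0)))))
    | zero => exact ⟨0, u, hg, hu.le⟩
    | succ s ih =>
      obtain ⟨r, u', hg', hs⟩ := ih
      have hC : C y (0 + s) := by simpa using hsub (hG.down' (hG.cod hg') hs)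
      obtain ⟨z, u₁, hg₁, hlex⟩ := hG.exists_add_le h hg hC
      obtain ⟨rfl, hu₁⟩ := (Prod.Lex.toLex_le_toLex.1 hlex).resolve_left (hle hg₁).not_gt
      exact ⟨_, u₁, hg₁, (h.add_one_le_iff.2 (lt_add_of_pos_left s hu)).trans hu₁⟩
  obtain ⟨r, u', hg', hs⟩ := unbounded
  exact hG.down' (hG.cod hg') hs

theorem image_le_of_succ {x t z u : M} (hle : ∀ {s z u}, G (x + 1) s z u → z ≤ x + 1)
    (hzero : C (x + 1) 0) (hsub : ∀ {s}, C' (x + 1) s → C (x + 1) s)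
    (huniv : (∀ s, C' (x + 1) s) → ∀ s, C x s) (hg : G x t z u) : z ≤ x := by
  by_contra! hxz
  obtain ⟨z₁, u₁, hg₁⟩ := hG.total hzero
  have hxz : x + 1 ≤ z := h.add_one_le_iff.2 hxz
  have hz : z ≤ z₁ := hG.fst_le hg hg₁ (lt_add_one x)
  obtain rfl : z₁ = x + 1 := le_antisymm (hle hg₁) (hxz.trans hz)
  obtain rfl : z = x + 1 := le_antisymm hz hxz
  have hu : toLex (x + 1, u) < toLex (x + 1, u₁) :=
    hG.mono hg hg₁ (Prod.Lex.toLex_lt_toLex.2 (.inl (lt_add_one x)))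
  have hu : u < u₁ := by simpa [Prod.Lex.toLex_lt_toLex] using hu
  have hC : ∀ s, C x s := huniv (hG.univ_of_image_self h hle hsub hg₁ (zero_le.trans_lt hu))
  exact (hG.fst_lt h hg hg₁ (lt_add_one x) (hC _)).false

theorem image_le {w T : M} (hD : Dominates C C' w T) (htop : ∀ {s z u}, G T s z u → z ≤ T)
    {y s z u : M} (hwy : w ≤ y) (hyT : y ≤ T) (hg : G y s z u) : z ≤ y := by
  by_contra! hyz
  obtain ⟨x, ⟨hwx, hxT, t, z₁, u₁, hg₁, hxz⟩, hmax⟩ := h.exists_greatest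
    (P := fun x => w ≤ x ∧ x ≤ T ∧ ∃ t z u, G x t z u ∧ x < z)
    (.and (.bdd (.le (.const w) (.var 0))) (.and (.bdd (.le (.var 0) (.const T)))
      (.ex (.ex (.ex (.and (hG.sigma.subst₄ (.var 3) (.var 2) (.var 1) (.var 0))
        (.bdd (.lt (.var 3) (.var 1)))))))))
    ⟨y, hwy, hyT, s, z, u, hg, hyz⟩ (b := T) fun x hx => hx.2.1
  have hxT : x < T := lt_of_le_of_ne hxT <| by
    rintro rfl
    exact hxz.not_ge (htop hg₁)
  have hx₁ : w ≤ x + 1 := hwx.trans (lt_add_one x).le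
  have hx₁T : x + 1 ≤ T := h.add_one_le_iff.2 hxT
  refine hxz.not_ge (hG.image_le_of_succ h (fun hg₂ => ?_) (hD.zero hx₁ hx₁T)
    (hD.subset hx₁ hx₁T) (hD.univ_of_succ hwx hxT) hg₁)
  by_contra! hlt
  exact (lt_add_one x).not_ge (hmax (x + 1) ⟨hx₁, hx₁T, _, _, _, hg₂, hlt⟩)

theorem exists_image_zero_lt_of_not_subset {x s : M} (hle : ∀ {s z u}, G x s z u → z ≤ x)
    (hC : C x s) (hC' : ¬ C' x s) : ∃ z u, z < x ∧ G x 0 z u := by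
  obtain ⟨z, u, hg⟩ := hG.total (hG.down hC zero_le)
  obtain ⟨z₁, u₁, hg₁, hlex⟩ := hG.exists_add_le h hg (s := s) (by simpa using hC)
  rcases Prod.Lex.toLex_le_toLex.1 hlex with hlt | ⟨rfl, hu⟩
  · exact ⟨z, u, hlt.trans_le (hle hg₁), hg⟩
  · refine ⟨z, u, lt_of_le_of_ne (hle hg) ?_, hg⟩
    rintro rfl
    exact hC' (hG.down' (hG.cod hg₁) (le_add_self.trans hu))

theorem exists_image_zero_lt_of_succ {y : M} (hsucc : ∃ z u, z < y + 1 ∧ G (y + 1) 0 z u)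
    (hzero : C y 0) (hsub : ∀ {s}, C' y s → C y s) : ∃ z u, z < y ∧ G y 0 z u := by
  obtain ⟨z₁, u₁, hz₁, hg₁⟩ := hsucc
  obtain ⟨z, u, hg⟩ := hG.total hzero
  refine ⟨z, u, ?_, hg⟩
  rcases (h.lt_add_one_iff.1 hz₁).lt_or_eq with hlt | rfl
  · exact (hG.fst_le hg hg₁ (lt_add_one y)).trans_lt hlt
  · exact hG.fst_lt h hg hg₁ (lt_add_one z₁) (by simpa using hsub (hG.cod hg₁))

theorem exists_image_zero_lt {w T x s : M} (hD : Dominates C C' w T)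
    (htop : ∀ {s z u}, G T s z u → z ≤ T) (hwx : w ≤ x) (hxT : x ≤ T) (hC : C x s)
    (hC' : ¬ C' x s) : ∃ z u, z < w ∧ G w 0 z u := by
  have hx := hG.exists_image_zero_lt_of_not_subset h (hG.image_le h hD htop hwx hxT) hC hC'
  obtain ⟨y, ⟨hwy, hyx, hy⟩, hmin⟩ := h.exists_least
    (P := fun y => w ≤ y ∧ y ≤ x ∧ ∃ z u, z < y ∧ G y 0 z u)
    (.and (.bdd (.le (.const w) (.var 0))) (.and (.bdd (.le (.var 0) (.const x)))
      (.ex (.ex (.and (.bdd (.lt (.var 1) (.var 2)))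
        (hG.sigma.subst₄ (.var 2) (.const 0) (.var 1) (.var 0)))))))
    ⟨x, hwx, le_rfl, hx⟩
  rcases hwy.eq_or_lt with rfl | hwy
  · exact hy
  obtain rfl | ⟨v, rfl⟩ := h.eq_zero_or_exists_eq_succ y
  · exact (hwy.not_ge zero_le).elim
  have hwv : w ≤ v := h.lt_add_one_iff.1 hwy
  have hvx : v < x := h.add_one_le_iff.1 hyx
  have hvT : v ≤ T := hvx.le.trans hxT
  have hv := hG.exists_image_zero_lt_of_succ h hy (hD.zero hwv hvT) (hD.subset hwv hvT)
  exact ((lt_add_one v).not_ge (hmin v ⟨hwv, hvx.le, hv⟩)).elim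

theorem exists_univ_image {y b : M} (hC : ∀ s, C y s) (hb : ∀ {s z u}, G y s z u → z ≤ b) :
    ∃ z, (∃ s u, G y s z u) ∧ (∀ {s z₁ u}, G y s z₁ u → z₁ ≤ z) ∧ ∀ t, C' z t := by
  obtain ⟨z₀, u₀, hg₀⟩ := hG.total (hC 0)
  obtain ⟨z, ⟨s, u, hg⟩, hmax⟩ := h.exists_greatest (P := fun z => ∃ s u, G y s z u)
    (.ex (.ex (hG.sigma.subst₄ (.const y) (.var 1) (.var 2) (.var 0)))) ⟨z₀, 0, u₀, hg₀⟩
    (b := b) fun z ⟨s, u, hg⟩ => hb hg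
  refine ⟨z, ⟨s, u, hg⟩, fun hg₁ => hmax _ ⟨_, _, hg₁⟩, fun t => ?_⟩
  obtain ⟨z₁, u₁, hg₁, hlex⟩ := hG.exists_add_le h hg (hC (s + t))
  obtain ⟨rfl, hu⟩ :=
    (Prod.Lex.toLex_le_toLex.1 hlex).resolve_left (hmax z₁ ⟨_, _, hg₁⟩).not_gt
  exact hG.down' (hG.cod hg₁) (le_add_self.trans hu)

end IsColumnMap

end ColumnMap

/-! ### The antichain of orders -/

section Antichain

variable {M : Type*} [CommSemiring M] [LinearOrder M] {S : Set (Set M)} {E : M → M → Prop}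
  {a i j x y t : M}

/-- `E 0 ⊆ E 1 ⊆ … ⊆ E a` are initial segments of the number domain, uniformly `Σ⁰₁`, and those of
them that are not the whole domain form a proper cut: a nonempty initial part of the sequence
that is closed under successor and does not contain `E a`. -/
structure IsCutFamily (S : Set (Set M)) (a : M) (E : M → M → Prop) : Prop where
  sigma : SigmaDefinable S 2 fun v => E (v 0) (v 1)
  down : ∀ {x r s}, E x s → r ≤ s → E x r
  mono : ∀ {x y r}, E x r → x ≤ y → E y r
  zero : ∀ x, E x 0
  not_univ_zero : ¬ ∀ r, E 0 r
  univ_of_succ : ∀ {x}, (∀ r, E (x + 1) r) → ∀ r, E x r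
  univ_last : ∀ r, E a r

/-- The column `y` of the first half of the `i`-th order. If `E y` has the greatest element `r`,
it has `(y + 1) * (r + 1) + min r i` elements, and otherwise it is the whole number domain. -/
def GrowingColumn (E : M → M → Prop) (i y t : M) : Prop :=
  ∃ r, E y r ∧ t < (y + 1) * (r + 1) + r ∧ t < (y + 1) * (r + 1) + i

/-- The column `y` of the second half of the `i`-th order. If `E y` has the greatest element `r`,
its greatest element is `r - i`, truncated at `0`, and otherwise it is the whole number domain. -/
def ShrinkingColumn (E : M → M → Prop) (i y t : M) : Prop :=
  ∃ r, E y r ∧ (t = 0 ∨ t + i ≤ r)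

/-- The columns of the `i`-th order: the growing ones for `0, …, a`, followed by the shrinking ones
for `0, …, a`, so that the column `a + 1 + z` of the order is the shrinking column `z`. -/
def Column (E : M → M → Prop) (a i y t : M) : Prop :=
  (y ≤ a ∧ GrowingColumn E i y t) ∨ ∃ z ≤ a, y = a + 1 + z ∧ ShrinkingColumn E i z t

variable [IsStrictOrderedRing M] [CanonicallyOrderedAdd M]

theorem column_of_le (hy : y ≤ a) : Column E a i y t ↔ GrowingColumn E i y t := by
  refine ⟨?_, fun hC => .inl ⟨hy, hC⟩⟩
  rintro (⟨-, hC⟩ | ⟨z, -, rfl, -⟩)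
  · exact hC
  · exact (hy.not_gt ((lt_add_one a).trans_le le_self_add)).elim

theorem column_add {z : M} (hz : z ≤ a) : Column E a i (a + 1 + z) t ↔ ShrinkingColumn E i z t := by
  refine ⟨?_, fun hC => .inr ⟨z, hz, rfl, hC⟩⟩
  rintro (⟨hle, -⟩ | ⟨z', -, heq, hC⟩)
  · exact (hle.not_gt ((lt_add_one a).trans_le le_self_add)).elim
  · rwa [add_left_cancel heq]

theorem Column.le_last (hC : Column E a i y t) : y ≤ a + 1 + a := by
  obtain ⟨hy, -⟩ | ⟨z, hz, rfl, -⟩ := hC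
  · exact hy.trans le_add_self
  · gcongr

namespace IsCutFamily

theorem growingColumn_zero (hE : IsCutFamily S a E) (i y : M) : GrowingColumn E i y 0 :=
  ⟨0, hE.zero y, by simp, by simp⟩

omit [IsStrictOrderedRing M] [CanonicallyOrderedAdd M] in
theorem shrinkingColumn_zero (hE : IsCutFamily S a E) (i y : M) : ShrinkingColumn E i y 0 :=
  ⟨0, hE.zero y, .inl rfl⟩

theorem growingColumn_univ_iff (hE : IsCutFamily S a E) :
    (∀ t, GrowingColumn E i y t) ↔ ∀ r, E y r := by
  refine ⟨fun hC r => ?_, fun hEy t => ⟨t, hEy t, ?_, ?_⟩⟩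
  · obtain ⟨s, hs, hlt, -⟩ := hC ((y + 1) * (r + 1) + r)
    refine hE.down hs (not_lt.1 fun hsr => hlt.not_ge ?_)
    gcongr
  · exact lt_add_of_pos_left t (by positivity)
  · calc t < t + 1 := lt_add_one t
      _ ≤ (y + 1) * (t + 1) := le_mul_of_one_le_left zero_le le_add_self
      _ ≤ (y + 1) * (t + 1) + i := le_self_add

theorem shrinkingColumn_univ_iff (hE : IsCutFamily S a E) :
    (∀ t, ShrinkingColumn E i y t) ↔ ∀ r, E y r := by
  refine ⟨fun hC r => ?_, fun hEy t => ⟨t + i, hEy _, .inr le_rfl⟩⟩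
  obtain ⟨s, hs, hzero | hle⟩ := hC (r + 1)
  · exact ((add_pos_of_nonneg_of_pos zero_le one_pos).ne' hzero).elim
  · exact hE.down hs ((lt_add_one r).le.trans (le_self_add.trans hle))

theorem column_univ_iff_of_le (hE : IsCutFamily S a E) (hy : y ≤ a) :
    (∀ t, Column E a i y t) ↔ ∀ r, E y r := by
  simp only [column_of_le hy, hE.growingColumn_univ_iff]

theorem column_add_univ_iff (hE : IsCutFamily S a E) {z : M} (hz : z ≤ a) :
    (∀ t, Column E a i (a + 1 + z) t) ↔ ∀ r, E z r := by
  simp only [column_add hz, hE.shrinkingColumn_univ_iff]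

end IsCutFamily

omit [IsStrictOrderedRing M] [CanonicallyOrderedAdd M] in
theorem GrowingColumn.down {s : M} (hC : GrowingColumn E i y t) (hs : s ≤ t) :
    GrowingColumn E i y s := by
  obtain ⟨r, hr, hlt, hlt'⟩ := hC
  exact ⟨r, hr, hs.trans_lt hlt, hs.trans_lt hlt'⟩

omit [CanonicallyOrderedAdd M] in
theorem GrowingColumn.mono (hij : i ≤ j) (hC : GrowingColumn E i y t) : GrowingColumn E j y t := by
  obtain ⟨r, hr, hlt, hlt'⟩ := hC
  exact ⟨r, hr, hlt, hlt'.trans_le (by gcongr)⟩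

omit [IsStrictOrderedRing M] in
/-- The factor `y + 1` makes up for any difference between `min r j` and `min r i`. -/
theorem IsCutFamily.growingColumn_succ (hE : IsCutFamily S a E) (i : M)
    (hC : GrowingColumn E j y t) : GrowingColumn E i (y + 1) t := by
  obtain ⟨r, hr, hlt, -⟩ := hC
  have hlt : t < (y + 1 + 1) * (r + 1) := calc
    t < (y + 1) * (r + 1) + r := hlt
    _ ≤ (y + 1) * (r + 1) + r + 1 := le_self_add
    _ = (y + 1 + 1) * (r + 1) := by ring
  exact ⟨r, hE.mono hr le_self_add, hlt.trans_le le_self_add, hlt.trans_le le_self_add⟩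

theorem ShrinkingColumn.down {s : M} (hC : ShrinkingColumn E i y t) (hs : s ≤ t) :
    ShrinkingColumn E i y s := by
  obtain ⟨r, hr, rfl | hle⟩ := hC
  · exact ⟨r, hr, .inl (le_antisymm hs zero_le)⟩
  · exact ⟨r, hr, .inr (le_trans (by gcongr) hle)⟩

omit [CanonicallyOrderedAdd M] in
theorem ShrinkingColumn.anti (hij : i ≤ j) (hC : ShrinkingColumn E j y t) :
    ShrinkingColumn E i y t := by
  obtain ⟨r, hr, hle⟩ := hC
  exact ⟨r, hr, hle.imp_right (le_trans (by gcongr))⟩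

theorem Column.down {s : M} (hC : Column E a i y t) (hs : s ≤ t) : Column E a i y s :=
  hC.imp (.imp_right (·.down hs)) fun ⟨z, hz, hy, hC⟩ => ⟨z, hz, hy, hC.down hs⟩

namespace IsCutFamily

theorem exists_last_gt (h : ModelsRCA0 S) (hE : IsCutFamily S a E) (i : M) :
    ∃ x r, x ≤ a ∧ i < r ∧ E x r ∧ ∀ s, E x s → s ≤ r := by
  obtain ⟨x, hx, hmin⟩ := h.exists_least (P := fun x => E x (i + 1))
    (hE.sigma.subst₂ (.var 0) (.const _)) ⟨a, hE.univ_last _⟩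
  have hx_univ : ¬ ∀ r, E x r := by
    intro huniv
    obtain rfl | ⟨v, rfl⟩ := h.eq_zero_or_exists_eq_succ x
    · exact hE.not_univ_zero huniv
    · exact (lt_add_one v).not_ge (hmin v (hE.univ_of_succ huniv _))
  push Not at hx_univ
  obtain ⟨b, hb⟩ := hx_univ
  obtain ⟨r, hr, hmax⟩ := h.exists_greatest (P := fun r => E x r)
    (hE.sigma.subst₂ (.const x) (.var 0)) ⟨_, hx⟩ (b := b)
    fun s hs => not_lt.1 fun hlt => hb (hE.down hs hlt.le)
  exact ⟨x, r, hmin a (hE.univ_last _), h.add_one_le_iff.1 (hmax _ hx), hr, hmax⟩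

theorem exists_growingColumn_not (h : ModelsRCA0 S) (hE : IsCutFamily S a E) (hij : j < i) :
    ∃ x ≤ a, ∃ t, GrowingColumn E i x t ∧ ¬ GrowingColumn E j x t := by
  obtain ⟨x, r, hx, hjr, hr, hmax⟩ := hE.exists_last_gt h j
  refine ⟨x, hx, (x + 1) * (r + 1) + j, ⟨r, hr, by gcongr, by gcongr⟩, ?_⟩
  rintro ⟨s, hs, -, hlt⟩
  have hsr : s ≤ r := hmax s hs
  refine hlt.not_ge ?_
  gcongr

theorem exists_shrinkingColumn_not (h : ModelsRCA0 S) (hE : IsCutFamily S a E) (hij : i < j) :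
    ∃ x ≤ a, ∃ t, ShrinkingColumn E i x t ∧ ¬ ShrinkingColumn E j x t := by
  obtain ⟨x, r, hx, hir, hr, hmax⟩ := hE.exists_last_gt h i
  obtain ⟨t, rfl⟩ := exists_add_of_le hir.le
  refine ⟨x, hx, t, ⟨i + t, hr, .inr (add_comm t i).le⟩, ?_⟩
  rintro ⟨s, hs, rfl | hle⟩
  · simp at hir
  · refine (hle.trans (hmax s hs)).not_gt ?_
    rw [add_comm i]
    gcongr

theorem dominates_growing (h : ModelsRCA0 S) (hE : IsCutFamily S a E) (hij : j ≤ i) :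
    Dominates (Column E a i) (Column E a j) 0 a where
  zero _ hy := (column_of_le hy).2 (hE.growingColumn_zero _ _)
  subset _ hy hC := (column_of_le hy).2 (((column_of_le hy).1 hC).mono hij)
  univ_of_succ _ hy hC := (hE.column_univ_iff_of_le hy.le).2 <| hE.univ_of_succ <|
    (hE.column_univ_iff_of_le (h.add_one_le_iff.2 hy)).1 hC

theorem dominates_shift (hE : IsCutFamily S a E) (i j : M) :
    Dominates (Column E a i) (ShiftedColumn (Column E a j)) 0 a where
  zero _ hy := (column_of_le hy).2 (hE.growingColumn_zero _ _)
  subset := by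
    rintro _ s - hy ⟨z, rfl, hC⟩
    exact (column_of_le hy).2 <| hE.growingColumn_succ i <|
      (column_of_le ((lt_add_one z).le.trans hy)).1 hC
  univ_of_succ := by
    rintro y - hy hC
    refine (hE.column_univ_iff_of_le hy.le).2 ((hE.column_univ_iff_of_le (i := j) hy.le).1 ?_)
    intro t
    obtain ⟨z, hz, hC⟩ := hC t
    rwa [add_right_cancel hz]

theorem dominates_shrinking (h : ModelsRCA0 S) (hE : IsCutFamily S a E) (hij : i ≤ j) :
    Dominates (Column E a i) (Column E a j) (a + 1) (a + 1 + a) where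
  zero hay hy := by
    obtain ⟨z, rfl⟩ := exists_add_of_le hay
    exact (column_add (le_of_add_le_add_left hy)).2 (hE.shrinkingColumn_zero _ _)
  subset hay hy hC := by
    obtain ⟨z, rfl⟩ := exists_add_of_le hay
    have hz : z ≤ a := le_of_add_le_add_left hy
    exact (column_add hz).2 (((column_add hz).1 hC).anti hij)
  univ_of_succ hay hy hC := by
    obtain ⟨z, rfl⟩ := exists_add_of_le hay
    have hz : z < a := lt_of_add_lt_add_left hy
    rw [add_assoc (a + 1) z 1] at hC
    exact (hE.column_add_univ_iff hz.le).2 <| hE.univ_of_succ <|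
      (hE.column_add_univ_iff (h.add_one_le_iff.2 hz)).1 hC

variable {G : M → M → M → M → Prop}

/-- Otherwise the shrinking columns of the `i`-th order start to the left of the column `a + 1` of
the `j`-th order, so that its growing columns move down by at least one. This is impossible already
for the column `0`. -/
theorem not_columnMap_of_lt (h : ModelsRCA0 S) (hE : IsCutFamily S a E) (hij : i < j) :
    ¬ IsColumnMap S (Column E a i) (Column E a j) G := by
  intro hG
  obtain ⟨x, hx, t, hC, hC'⟩ := hE.exists_shrinkingColumn_not h hij
  obtain ⟨z, u, hz, hg⟩ := hG.exists_image_zero_lt h (hE.dominates_shrinking h hij.le)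
    (fun hg => (hG.cod hg).le_last) le_self_add (by gcongr : a + 1 + x ≤ a + 1 + a)
    ((column_add hx).2 hC) (mt (column_add hx).1 hC')
  have image_last_lt {s z' u' : M} (hg' : G a s z' u') : z' < a :=
    (hG.fst_lt h hg' hg (lt_add_one a)
      ((hE.column_univ_iff_of_le le_rfl).2 hE.univ_last _)).trans_le (h.lt_add_one_iff.1 hz)
  obtain ⟨_, _, hlt, -⟩ := hG.shift.exists_image_zero_lt h (hE.dominates_shift i j)
    (fun ⟨z', hz', hg'⟩ => hz' ▸ h.add_one_le_iff.2 (image_last_lt hg')) (x := 0) (s := 0) le_rfl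
    zero_le ((column_of_le zero_le).2 (hE.growingColumn_zero i 0))
    fun ⟨z, hz, _⟩ => h.succ_ne_zero z hz.symm
  exact hlt.not_ge zero_le

theorem image_last_le (h : ModelsRCA0 S) (hE : IsCutFamily S a E)
    (hG : IsColumnMap S (Column E a i) (Column E a j) G) {s z u : M} (hg : G a s z u) :
    z ≤ a := by
  by_contra! haz
  obtain ⟨y, ⟨r, u', hg'⟩, hmax, huniv⟩ := hG.exists_univ_image h
    ((hE.column_univ_iff_of_le le_rfl).2 hE.univ_last) fun hg => (hG.cod hg).le_last
  obtain ⟨w, rfl⟩ := exists_add_of_le (h.add_one_le_iff.2 (haz.trans_le (hmax hg)))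
  have hw : w ≤ a := le_of_add_le_add_left (hG.cod hg').le_last
  have hEw : ∀ r, E w r := (hE.column_add_univ_iff hw).1 huniv
  obtain rfl | ⟨v, rfl⟩ := h.eq_zero_or_exists_eq_succ w
  · exact hE.not_univ_zero hEw
  have hv : v ≤ a := (lt_add_one v).le.trans hw
  have hEv : ∀ r, E v r := hE.univ_of_succ hEw
  have hC (x : M) (hvx : a + 1 + v ≤ x) (hxa : x ≤ a + 1 + a) : ∀ s, Column E a i x s := by
    obtain ⟨x, rfl⟩ := exists_add_of_le (le_self_add.trans hvx)
    refine (hE.column_add_univ_iff (le_of_add_le_add_left hxa)).2 fun r => ?_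
    exact hE.mono (hEv r) (le_of_add_le_add_left hvx)
  have hva : a + 1 + v ≤ a + 1 + a := by gcongr
  obtain ⟨z₁, u₁, hg₁⟩ := hG.total (hC _ le_rfl hva 0)
  have hz₁ : z₁ ≤ a + 1 + v :=
    hG.image_le h (.of_univ hC) (fun hg => (hG.cod hg).le_last) le_rfl hva hg₁
  have hle : a + 1 + (v + 1) ≤ z₁ :=
    hG.fst_le hg' hg₁ ((lt_add_one a).trans_le le_self_add)
  exact (hle.trans hz₁).not_gt (by gcongr; exact lt_add_one v)

theorem not_columnMap_of_gt (h : ModelsRCA0 S) (hE : IsCutFamily S a E) (hij : j < i) :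
    ¬ IsColumnMap S (Column E a i) (Column E a j) G := by
  intro hG
  obtain ⟨x, hx, t, hC, hC'⟩ := hE.exists_growingColumn_not h hij
  obtain ⟨_, _, hlt, -⟩ := hG.exists_image_zero_lt h (hE.dominates_growing h hij.le)
    (hE.image_last_le h hG) zero_le hx ((column_of_le hx).2 hC) (mt (column_of_le hx).1 hC')
  exact hlt.not_ge zero_le

theorem not_columnMap (h : ModelsRCA0 S) (hE : IsCutFamily S a E) (hij : i ≠ j) :
    ¬ IsColumnMap S (Column E a i) (Column E a j) G :=
  hij.lt_or_gt.elim (hE.not_columnMap_of_lt h) (hE.not_columnMap_of_gt h)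

theorem sigmaDefinable_column (hE : IsCutFamily S a E) :
    SigmaDefinable S 3 fun v => Column E a (v 0) (v 1) (v 2) := by
  refine .or (.and (.bdd (.le (.var 1) (.const a))) (.ex (.and (hE.sigma.subst₂ (.var 2) (.var 0))
    (.bdd ?_)))) (.ex (.and (.bdd (.le (.var 0) (.const a))) (.and (.bdd ?_)
      (.ex (.and (hE.sigma.subst₂ (.var 1) (.var 0)) (.bdd ?_))))))
  · repeat' constructor
  · repeat' constructor
  · exact .or (.eq (.var 4) (.const 0)) (.le (.add (.var 4) (.var 2)) (.var 0))

end IsCutFamily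

end Antichain

/-! ### A cut family from a failure of induction -/

section CutFamily

variable {M : Type*} [LinearOrder M] {T : M → M → M → Prop}

/-- No number below `r` is a witness of `∃ u, ∀ v, T v u y`, for some `y ≤ x`. For a bounded
relation `T` this is a `Σ⁰₁` relation between `x` and `r`. -/
def NoWitnessBelow (T : M → M → M → Prop) (x r : M) : Prop :=
  ∃ y ≤ x, ∀ u < r, ∃ v, ¬ T v u y

theorem exists_witness_of_not_noWitnessBelow {x r y : M} (hx : ¬ NoWitnessBelow T x r)
    (hy : y ≤ x) : ∃ u < r, ∀ v, T v u y := by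
  simp only [NoWitnessBelow] at hx
  push Not at hx
  exact hx y hy

variable [CommSemiring M] [IsStrictOrderedRing M] [CanonicallyOrderedAdd M] {S : Set (Set M)}

theorem sigmaDefinable_noWitnessBelow (h : ModelsRCA0 S)
    (hT : BddDefinable S 3 fun v => T (v 0) (v 1) (v 2)) :
    SigmaDefinable S 2 fun v => NoWitnessBelow T (v 0) (v 1) :=
  .ex (.and (.bdd (.le (.var 0) (.var 1))) (.ball h (.var 2)
    (.ex (P := fun w v => ¬ T v (w 0) (w 1)) (.bdd (.not (hT.subst₃ (.var 0) (.var 1) (.var 2)))))))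

omit [IsStrictOrderedRing M] in
theorem noWitnessBelow_univ_of_succ (h : ModelsRCA0 S) {x : M}
    (hs : (∃ u, ∀ v, T v u x) → ∃ u, ∀ v, T v u (x + 1))
    (hx : ∀ r, NoWitnessBelow T (x + 1) r) (r : M) : NoWitnessBelow T x r := by
  by_contra hr
  obtain ⟨u₀, -, hu₀⟩ := exists_witness_of_not_noWitnessBelow hr le_rfl
  obtain ⟨u₁, hu₁⟩ := hs ⟨u₀, hu₀⟩
  obtain ⟨y, hy, hno⟩ := hx (r + u₁ + 1)
  have hex : ∃ u < r + u₁ + 1, ∀ v, T v u y := by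
    rcases hy.lt_or_eq with hy | rfl
    · obtain ⟨u, hu, hT⟩ :=
        exists_witness_of_not_noWitnessBelow hr (h.lt_add_one_iff.1 hy)
      exact ⟨u, h.lt_add_one_iff.2 (hu.le.trans le_self_add), hT⟩
    · exact ⟨u₁, h.lt_add_one_iff.2 le_add_self, hu₁⟩
  obtain ⟨u, hu, hT⟩ := hex
  obtain ⟨v, hv⟩ := hno u hu
  exact hv (hT v)

theorem isCutFamily_noWitnessBelow (h : ModelsRCA0 S)
    (hT : BddDefinable S 3 fun v => T (v 0) (v 1) (v 2)) (h₀ : ∃ u, ∀ v, T v u 0)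
    (hs : ∀ x, (∃ u, ∀ v, T v u x) → ∃ u, ∀ v, T v u (x + 1)) {a : M}
    (ha : ¬ ∃ u, ∀ v, T v u a) : IsCutFamily S a (NoWitnessBelow T) where
  sigma := sigmaDefinable_noWitnessBelow h hT
  down := fun ⟨y, hy, hno⟩ hrs => ⟨y, hy, fun u hu => hno u (hu.trans_le hrs)⟩
  mono := fun ⟨y, hy, hno⟩ hxy => ⟨y, hy.trans hxy, hno⟩
  zero x := ⟨x, le_rfl, fun u hu => (h.not_lt_zero u hu).elim⟩
  not_univ_zero huniv := by
    obtain ⟨u, hu⟩ := h₀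
    obtain ⟨y, hy, hno⟩ := huniv (u + 1)
    obtain rfl : y = 0 := le_antisymm hy zero_le
    obtain ⟨v, hv⟩ := hno u (lt_add_one u)
    exact hv (hu v)
  univ_of_succ := noWitnessBelow_univ_of_succ h (hs _)
  univ_last r := by
    by_contra hr
    obtain ⟨u, -, hu⟩ := exists_witness_of_not_noWitnessBelow hr le_rfl
    exact ha ⟨u, hu⟩

end CutFamily

/-! ### Coding lexicographic sums -/

section Coding

variable {M : Type*} [CommSemiring M] [LinearOrder M] {S : Set (Set M)}

/-- The pairs `(y, t)` with `C y t` are represented by the numbers `e` with `R y t e`. The number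
`e` is not just `pair y t` because `C` is only `Σ⁰₁`: it contains a witness of `C y t` as well. -/
structure IsPairCoding (C : M → M → Prop) (R : M → M → M → Prop) : Prop where
  column_iff : ∀ {y t}, C y t ↔ ∃ e, R y t e
  code_unique : ∀ {y t e e'}, R y t e → R y t e' → e = e'
  pair_unique : ∀ {y t y' t' e}, R y t e → R y' t' e → y = y' ∧ t = t'
  le_code : ∀ {y t e}, R y t e → y ≤ e ∧ t ≤ e

/-- `L` codes the lexicographic order on the pairs `(y, t)` with `C y t`, represented by numbers
as prescribed by `R`. -/
structure IsLexSum (S : Set (Set M)) (C : M → M → Prop) (R : M → M → M → Prop) (L : Set M) : Prop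
    extends IsPairCoding C R where
  bdd : BddDefinable S 3 fun v => R (v 0) (v 1) (v 2)
  le_iff : ∀ {e e'}, le L e e' ↔
    ∃ y t y' t', R y t e ∧ R y' t' e' ∧ toLex (y, t) ≤ toLex (y', t')

omit [LinearOrder M] in
theorem TermDefinable.pair {n : ℕ} {f g : (Fin n → M) → M} (hf : TermDefinable n f)
    (hg : TermDefinable n g) : TermDefinable n fun v => pair (f v) (g v) :=
  .add (.mul (.add hf hg) (.add hf hg)) hf

namespace IsLexSum

variable {C : M → M → Prop} {R : M → M → M → Prop} {L : Set M}

theorem mem_field_iff (hL : IsLexSum S C R L) {e : M} : e ∈ field L ↔ ∃ y t, R y t e :=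
  ⟨fun he => let ⟨y, t, _, _, hR, _⟩ := hL.le_iff.1 he; ⟨y, t, hR⟩,
    fun ⟨y, t, hR⟩ => hL.le_iff.2 ⟨y, t, y, t, hR, hR, le_rfl⟩⟩

theorem le_iff_toLex_le (hL : IsLexSum S C R L) {y t e y' t' e' : M} (hR : R y t e)
    (hR' : R y' t' e') : le L e e' ↔ toLex (y, t) ≤ toLex (y', t') := by
  refine hL.le_iff.trans ⟨?_, fun hle => ⟨y, t, y', t', hR, hR', hle⟩⟩
  rintro ⟨y₁, t₁, y₁', t₁', hR₁, hR₁', hle⟩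
  obtain ⟨rfl, rfl⟩ := hL.pair_unique hR hR₁
  obtain ⟨rfl, rfl⟩ := hL.pair_unique hR' hR₁'
  exact hle

theorem eq_iff_toLex_eq (hL : IsLexSum S C R L) {y t e y' t' e' : M} (hR : R y t e)
    (hR' : R y' t' e') : e = e' ↔ toLex (y, t) = toLex (y', t') := by
  rw [toLex_inj, Prod.mk.injEq]
  constructor
  · rintro rfl
    exact hL.pair_unique hR hR'
  · rintro ⟨rfl, rfl⟩
    exact hL.code_unique hR hR'

theorem lt_iff_toLex_lt (hL : IsLexSum S C R L) {y t e y' t' e' : M} (hR : R y t e)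
    (hR' : R y' t' e') : lt L e e' ↔ toLex (y, t) < toLex (y', t') := by
  rw [lt_iff_le_and_ne, lt, hL.le_iff_toLex_le hR hR', Ne, hL.eq_iff_toLex_eq hR hR']

theorem isLinOrder (hL : IsLexSum S C R L) : IsLinOrder L where
  refl e e' hle := by
    obtain ⟨y, t, y', t', hR, hR', -⟩ := hL.le_iff.1 hle
    exact ⟨hL.mem_field_iff.2 ⟨y, t, hR⟩, hL.mem_field_iff.2 ⟨y', t', hR'⟩⟩
  antisymm e e' hle hle' := by
    obtain ⟨y, t, y', t', hR, hR', hlex⟩ := hL.le_iff.1 hle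
    exact (hL.eq_iff_toLex_eq hR hR').2 (le_antisymm hlex ((hL.le_iff_toLex_le hR' hR).1 hle'))
  trans e e' e'' hle hle' := by
    obtain ⟨y, t, y', t', hR, hR', hlex⟩ := hL.le_iff.1 hle
    obtain ⟨_, _, y'', t'', -, hR'', -⟩ := hL.le_iff.1 hle'
    exact (hL.le_iff_toLex_le hR hR'').2 (hlex.trans ((hL.le_iff_toLex_le hR' hR'').1 hle'))
  total e he e' he' := by
    obtain ⟨y, t, hR⟩ := hL.mem_field_iff.1 he
    obtain ⟨y', t', hR'⟩ := hL.mem_field_iff.1 he'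
    rw [hL.le_iff_toLex_le hR hR', hL.le_iff_toLex_le hR' hR]
    exact le_total _ _

end IsLexSum

variable [IsStrictOrderedRing M] [CanonicallyOrderedAdd M]

omit [IsStrictOrderedRing M] in
theorem left_le_pair (m n : M) : m ≤ pair m n := le_add_self

namespace ModelsRCA0

theorem right_le_pair (h : ModelsRCA0 S) (m n : M) : n ≤ pair m n := by
  have hn : n ≤ n * n := by
    obtain rfl | ⟨k, rfl⟩ := h.eq_zero_or_exists_eq_succ n
    · simp
    · exact le_mul_of_one_le_left zero_le le_add_self
  calc n ≤ n * n := hn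
    _ ≤ (m + n) * (m + n) := by gcongr <;> exact le_add_self
    _ ≤ pair m n := le_self_add

theorem pair_lt_pair (h : ModelsRCA0 S) {m n m' n' : M} (hlt : m + n < m' + n') :
    pair m n < pair m' n' := by
  have hle : m + n + 1 ≤ m' + n' := h.add_one_le_iff.2 hlt
  calc pair m n ≤ (m + n) * (m + n) + (m + n) := by unfold pair; gcongr; exact le_self_add
    _ < (m + n) * (m + n) + (m + n) + ((m + n) + 1) :=
      lt_add_of_pos_right _ (zero_le.trans_lt (lt_add_one _))
    _ = (m + n + 1) * (m + n + 1) := by ring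
    _ ≤ (m' + n') * (m' + n') := mul_le_mul' hle hle
    _ ≤ pair m' n' := le_self_add

theorem pair_inj (h : ModelsRCA0 S) {m n m' n' : M} :
    pair m n = pair m' n' ↔ m = m' ∧ n = n' := by
  refine ⟨fun heq => ?_, by rintro ⟨rfl, rfl⟩; rfl⟩
  have hsum : m + n = m' + n' := le_antisymm
    (not_lt.1 fun hlt => (h.pair_lt_pair hlt).ne' heq)
    (not_lt.1 fun hlt => (h.pair_lt_pair hlt).ne heq)
  simp only [pair, hsum] at heq
  obtain rfl : m = m' := add_left_cancel heq
  exact ⟨rfl, add_left_cancel hsum⟩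

theorem exists_sequence (h : ModelsRCA0 S) {R : M → M → M → Prop}
    (hR : BddDefinable S 3 fun v => R (v 0) (v 1) (v 2)) :
    ∃ Z ∈ S, ∀ i e e', le (nth Z i) e e' ↔ R i e e' := by
  obtain ⟨Z, hZ, hmem⟩ := h.exists_set
    (P := fun c => ∃ i < c + 1, ∃ e < c + 1, ∃ e' < c + 1, c = pair (pair e e') i ∧ R i e e')
    (.bex (.add (.var 0) (.const 1)) (.bex (.add (.var 1) (.const 1)) (.bex
      (.add (.var 2) (.const 1)) (.and (.eq (.var 3) (.pair (.pair (.var 1) (.var 0)) (.var 2)))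
        (hR.subst₃ (.var 2) (.var 1) (.var 0))))))
  refine ⟨Z, hZ, fun i e e' => (hmem _).trans ⟨?_, fun hR => ?_⟩⟩
  · rintro ⟨i', -, e₁, -, e₁', -, heq, hR⟩
    obtain ⟨⟨rfl, rfl⟩, rfl⟩ := (h.pair_inj.trans (and_congr_left' h.pair_inj)).1 heq
    exact hR
  · have hle : pair e e' ≤ pair (pair e e') i := left_le_pair _ _
    simp only [h.lt_add_one_iff]
    exact ⟨i, h.right_le_pair _ _, e, (left_le_pair _ _).trans hle, e',
      (h.right_le_pair _ _).trans hle, rfl, hR⟩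

theorem snd_mem (h : ModelsRCA0 S) {F A B : Set M} (hF : IsFunction F A B) {a b : M}
    (hab : pair a b ∈ F) : b ∈ B := by
  obtain ⟨_, -, _, hb, heq⟩ := hF.1 _ hab
  obtain ⟨-, rfl⟩ := h.pair_inj.1 heq
  exact hb

theorem exists_isPairCoding (h : ModelsRCA0 S) {C : M → M → M → Prop}
    (hC : SigmaDefinable S 3 fun v => C (v 0) (v 1) (v 2)) :
    ∃ R : M → M → M → M → Prop, BddDefinable S 4 (fun v => R (v 0) (v 1) (v 2) (v 3)) ∧
      ∀ i, IsPairCoding (C i) (R i) := by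
  obtain ⟨Q, hQ, hCQ, unique⟩ := hC.exists_unique_witness h
  refine ⟨fun i y t e => ∃ w < e + 1, e = pair (pair y t) w ∧ Q ![w, i, y, t], ?_, fun i =>
    { column_iff := ?_, code_unique := ?_, pair_unique := ?_, le_code := ?_ }⟩
  · exact .bex (.add (.var 3) (.const 1)) (.and (.eq (.var 4) (.pair (.pair (.var 2) (.var 3))
      (.var 0))) (hQ.subst (f := fun v => ![v 0, v 1, v 2, v 3]) fun i => by
        fin_cases i <;> constructor))
  · intro y t
    refine (hCQ ![i, y, t]).trans ⟨fun ⟨w, hw⟩ => ?_, fun ⟨_, w, _, _, hw⟩ => ⟨w, hw⟩⟩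
    exact ⟨_, w, h.lt_add_one_iff.2 (h.right_le_pair _ _), rfl, hw⟩
  · rintro y t _ _ ⟨w, -, rfl, hw⟩ ⟨w', -, rfl, hw'⟩
    rw [unique ![i, y, t] w w' hw hw']
  · rintro y t y' t' _ ⟨w, -, rfl, -⟩ ⟨w', -, heq, -⟩
    exact h.pair_inj.1 (h.pair_inj.1 heq).1
  · rintro y t _ ⟨w, -, rfl, -⟩
    exact ⟨(left_le_pair y t).trans (left_le_pair _ w),
      (h.right_le_pair y t).trans (left_le_pair _ w)⟩

theorem exists_isLexSum (h : ModelsRCA0 S) {C : M → M → M → Prop}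
    (hC : SigmaDefinable S 3 fun v => C (v 0) (v 1) (v 2)) :
    ∃ (R : M → M → M → M → Prop) (Z : Set M), Z ∈ S ∧ ∀ i, IsLexSum S (C i) (R i) (nth Z i) := by
  obtain ⟨R, hR, hcode⟩ := h.exists_isPairCoding hC
  obtain ⟨Z, hZ, hZ_le⟩ := h.exists_sequence
    (R := fun i e e' => ∃ y < e + 1, ∃ t < e + 1, ∃ y' < e' + 1, ∃ t' < e' + 1,
      R i y t e ∧ R i y' t' e' ∧ toLex (y, t) ≤ toLex (y', t'))
    (.bex (.add (.var 1) (.const 1)) (.bex (.add (.var 2) (.const 1)) (.bex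
      (.add (.var 4) (.const 1)) (.bex (.add (.var 5) (.const 1)) (.and
        (hR.subst₄ (.var 4) (.var 3) (.var 2) (.var 5)) (.and
          (hR.subst₄ (.var 4) (.var 1) (.var 0) (.var 6))
          (.toLex_le (.var 3) (.var 2) (.var 1) (.var 0))))))))
  refine ⟨R, Z, hZ, fun i => ⟨hcode i, hR.subst₄ (.const i) (.var 0) (.var 1) (.var 2),
    (hZ_le i _ _).trans ⟨?_, ?_⟩⟩⟩
  · rintro ⟨y, -, t, -, y', -, t', -, hlex⟩
    exact ⟨y, t, y', t', hlex⟩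
  · rintro ⟨y, t, y', t', hyt, hyt', hle⟩
    obtain ⟨⟨hy, ht⟩, hy', ht'⟩ := (hcode i).le_code hyt, (hcode i).le_code hyt'
    simp only [h.lt_add_one_iff]
    exact ⟨y, hy, t, ht, y', hy', t', ht', hyt, hyt', hle⟩

end ModelsRCA0

namespace IsLexSum

variable {C C' : M → M → Prop} {R R' : M → M → M → Prop} {L L' : Set M}

theorem isWellOrder (h : ModelsRCA0 S) (hL : IsLexSum S C R L) : IsWellOrder S L := by
  refine ⟨hL.isLinOrder, ?_⟩
  rintro ⟨F, hF, hfun, hdesc⟩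
  have value (n : M) : ∃ e y t, pair n e ∈ F ∧ R y t e := by
    obtain ⟨e, he, -⟩ := hfun.2 n (Set.mem_univ n)
    obtain ⟨y, t, hR⟩ := hL.mem_field_iff.1 (h.snd_mem hfun he)
    exact ⟨e, y, t, he, hR⟩
  obtain ⟨e₀, y₀, t₀, he₀, hR₀⟩ := value 0
  obtain ⟨y, t, ⟨n, e, he, hR⟩, hleast⟩ := h.exists_least_toLex
    (P := fun y t => ∃ n e, pair n e ∈ F ∧ R y t e)
    (.ex (.ex (.bdd (.and (.mem hF (.pair (.var 1) (.var 0)))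
      (hL.bdd.subst₃ (.var 2) (.var 3) (.var 0)))))) ⟨y₀, t₀, 0, e₀, he₀, hR₀⟩
  obtain ⟨e', y', t', he', hR'⟩ := value (n + 1)
  have hlt : toLex (y', t') < toLex (y, t) :=
    (hL.lt_iff_toLex_lt hR' hR).1 (hdesc n e e' he he')
  exact hlt.not_ge (hleast y' t' ⟨n + 1, e', he', hR'⟩)

theorem exists_columnMap (h : ModelsRCA0 S) (hL : IsLexSum S C R L) (hL' : IsLexSum S C' R' L')
    (down : ∀ {y s t}, C y t → s ≤ t → C y s) (down' : ∀ {y s t}, C' y t → s ≤ t → C' y s)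
    (hemb : Embeds S L L') : ∃ G, IsColumnMap S C C' G := by
  obtain ⟨F, hF, hfun, hmono⟩ := hemb
  refine ⟨fun y t z u => ∃ e e', R y t e ∧ R' z u e' ∧ pair e e' ∈ F, ?_, down, down', ?_, ?_, ?_⟩
  · exact .ex (.ex (.bdd (.and (hL.bdd.subst₃ (.var 2) (.var 3) (.var 1)) (.and
      (hL'.bdd.subst₃ (.var 4) (.var 5) (.var 0)) (.mem hF (.pair (.var 1) (.var 0)))))))
  · intro y t hC
    obtain ⟨e, hR⟩ := hL.column_iff.1 hC
    obtain ⟨e', he', -⟩ := hfun.2 e (hL.mem_field_iff.2 ⟨y, t, hR⟩)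
    obtain ⟨z, u, hR'⟩ := hL'.mem_field_iff.1 (h.snd_mem hfun he')
    exact ⟨z, u, e, e', hR, hR', he'⟩
  · rintro y t z u ⟨e, e', -, hR', -⟩
    exact hL'.column_iff.2 ⟨e', hR'⟩
  · rintro y t z u y₁ t₁ z₁ u₁ ⟨e, e', hR, hR', hF⟩ ⟨e₁, e₁', hR₁, hR₁', hF₁⟩ hlt
    exact (hL'.lt_iff_toLex_lt hR' hR₁').1 <|
      hmono e e₁ e' e₁' hF hF₁ ((hL.lt_iff_toLex_lt hR hR₁).2 hlt)

end IsLexSum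

end Coding

end SecondOrderArithmetic

theorem mainTheorem6 {M : Type*} [Zero M] [One M] [Add M] [Mul M] [LT M] (S : Set (Set M))
    (hRCA : SecondOrderArithmetic.ModelsRCA0 S) (hWF : SecondOrderArithmetic.WF2 S) :
    SecondOrderArithmetic.Sigma02Induction S := by
  let _ := hRCA.commSemiring
  let _ := hRCA.linearOrder
  have := hRCA.isStrictOrderedRing
  have := hRCA.canonicallyOrderedAdd
  intro P hP h₀ hs a
  obtain ⟨T, hT, hPT⟩ := hP.exists_bddDefinable
  simp only [hPT] at h₀ hs ⊢
  by_contra ha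
  have hE := SecondOrderArithmetic.isCutFamily_noWitnessBelow hRCA hT h₀ hs ha
  obtain ⟨R, Z, hZ, hlex⟩ := hRCA.exists_isLexSum hE.sigmaDefinable_column
  obtain ⟨i, j, hij, hemb⟩ := hWF Z hZ fun i => (hlex i).isWellOrder hRCA
  obtain ⟨G, hG⟩ := (hlex i).exists_columnMap hRCA (hlex j) (·.down) (·.down) hemb
  exact hE.not_columnMap hRCA hij hG
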